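/- Let $L/F$ be a finite Galois extension of fields whose Galois group $G$ is isomorphic to the quaternion group of order $8$, and let $\sigma,\tau$ be generators of $G$ with $\sigma^4=\tau^4=1$, $\sigma^2=\tau^2$, $\sigma\tau=\tau\sigma^{-1}$. Let $\lambda,\rho:G\to\mathrm{Perm}(G)$ be the left and right regular representations, $\lambda(g)(x)=gx$ and $\rho(g)(x)=xg^{-1}$. A subgroup $N\le\mathrm{Perm}(G)$ is regular if $|N|=|G|$, $N$ acts transitively on $G$, and all point stabilisers in $N$ are trivial. A Hopf–Galois structure on $L/F$ is a finite-dimensional $F$-Hopf algebra $H$ together with an action of $H$ on $L$ making $L$ an $H$-module algebra, such that the $F$-linear map $L\otimes_F H\to\mathrm{End}_F(L)$, $l\otimes h\mapsto(x\mapsto l\,h(x))$, is bijective; two such structures are identified if there is an isomorphism of $F$-Hopf algebras between them compatible with the actions on $L$. Given a regular subgroup $N$ of $\mathrm{Perm}(G)$ normalized by $\lambda(G)$, let $G$ act on the group algebra $L[N]$ by Galois automorphisms on $L$ and by ${}^g\eta=\lambda(g)\eta\lambda(g)^{-1}$ on $N$. We say that a Hopf–Galois structure has underlying group $N$ if it is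 isomorphic to the fixed ring $L[N]^G$, with the Hopf algebra structure coming from $L[N]$ and the action $\left(\sum_{\eta\in N}c_\eta\eta\right)(x)=\sum_{\eta\in N}c_\eta\,\bigl(\eta^{-1}(1_G)\bigr)(x)$ on $L$; its type is then the isomorphism class of $N$. For $\{s,t\}=\{\sigma,\tau\}$ let $$E_{s,t}=\langle \lambda(s)\rho(t),\ \lambda(s^2),\ \lambda(t)\rho(st)\rangle\le\mathrm{Perm}(G).$$ Then $E_{s,t}$ is a regular subgroup of $\mathrm{Perm}(G)$, of order $8$, normalized by $\lambda(G)$ and isomorphic to $C_2\times C_2\times C_2$. The groups $E_{\sigma,\tau}$ and $E_{\tau,\sigma}$ are distinct, and they are the underlying groups of the two Hopf–Galois structures of type $C_2\times C_2\times C_2$ on $L/F$. That is, there are non-isomorphic Hopf–Galois structures $S_1,S_2$ on $L/F$ such that $E_{\sigma,\tau}$ is the only underlying group of $S_1$ and $E_{\tau,\sigma}$ is the only underlying group of $S_2$, and a Hopf–Galois structure on $L/F$ is of type $C_2\times C_2\times C_2$ if and only if it is isomorphic to $S_1$ or to $S_2$. -/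

import Mathlib

open scoped TensorProduct

universe u v

section Perm

variable {G : Type*} [Group G]

/-- The left regular representation `λ : G → Perm(G)`, `λ(g)(x) = g x`. -/
def leftReg : G →* Equiv.Perm G where
  toFun g := Equiv.mulLeft g
  map_one' := by ext x; simp
  map_mul' g h := by ext x; simp

/-- The right regular representation `ρ : G → Perm(G)`, `ρ(g)(x) = x g⁻¹`. -/
def rightReg : G →* Equiv.Perm G where
  toFun g := Equiv.mulRight g⁻¹
  map_one' := by ext x; simp
  map_mul' g h := by ext x; simp [mul_assoc]

/-- A subgroup `N` of `Perm(G)` is regular if `|N| = |G|`, all point stabilisers in `N` are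
trivial, and `N` acts transitively on `G`. -/
structure IsRegularSubgroup (N : Subgroup (Equiv.Perm G)) : Prop where
  card_eq : Nat.card N = Nat.card G
  stabilizer_trivial : ∀ g : G, ∀ η ∈ N, η g = g → η = 1
  transitive : ∀ g h : G, ∃ η ∈ N, η g = h

/-- `N` is normalised by `λ(G)`: it is stable under conjugation by every `λ(g)`, and hence, as this
also applies to `g⁻¹`, one has `λ(g) N λ(g)⁻¹ = N`. -/
def IsNormalizedByLeftReg (N : Subgroup (Equiv.Perm G)) : Prop :=
  ∀ g : G, ∀ η ∈ N, leftReg g * η * (leftReg g)⁻¹ ∈ N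

/-- The action of `g ∈ G` on a subgroup `N` normalised by `λ(G)`: `η ↦ λ(g) η λ(g)⁻¹`. -/
def twistedConj {N : Subgroup (Equiv.Perm G)} (hN : IsNormalizedByLeftReg N) (g : G) :
    N ≃* N where
  toFun η := ⟨leftReg g * η * (leftReg g)⁻¹, hN g η η.2⟩
  invFun η := ⟨leftReg g⁻¹ * η * (leftReg g⁻¹)⁻¹, hN g⁻¹ η η.2⟩
  left_inv η := by ext1; simp [mul_assoc]
  right_inv η := by ext1; simp [mul_assoc]
  map_mul' η θ := by ext1; simp [mul_assoc]

/-- `E_{s,t}`, the subgroup of `Perm(G)` generated by `λ(s)ρ(t)`, `λ(s²)` and `λ(t)ρ(st)`. -/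
def groupE (s t : G) : Subgroup (Equiv.Perm G) :=
  Subgroup.closure
    {leftReg s * rightReg t, leftReg (s ^ 2), leftReg t * rightReg (s * t)}

end Perm

/-- The group `C₂ × C₂ × C₂`. -/
abbrev C2Cubed : Type :=
  Multiplicative (ZMod 2) × Multiplicative (ZMod 2) × Multiplicative (ZMod 2)

/-- A Hopf–Galois structure on `L/F`: a finite-dimensional `F`-Hopf algebra `H` and an `F`-linear
action of `H` on `L` making `L` an `H`-module algebra, such that the map
`j : L ⊗ H → End_F(L)`, `j(l ⊗ h)(x) = l h(x)`, is bijective. -/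
structure HopfGaloisStructure (F : Type u) (L : Type v) [Field F] [Field L] [Algebra F L] where
  H : Type v
  [instRing : Ring H]
  [instHopfAlgebra : HopfAlgebra F H]
  finite : Module.Finite F H
  /-- The module structure: `act h x` is `h(x)`. -/
  act : H →ₐ[F] Module.End F L
  /-- `h(xy) = ∑ h₍₁₎(x) h₍₂₎(y)`. -/
  act_mul : ∀ (h : H) (x y : L), act h (x * y) =
    LinearMap.mul' F L (TensorProduct.map (act.toLinearMap.flip x) (act.toLinearMap.flip y)
      (Coalgebra.comul (R := F) h))
  /-- `h(1) = ε(h) 1`. -/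
  act_one : ∀ h : H, act h 1 = algebraMap F L (Coalgebra.counit (R := F) h)
  /-- The map `j` is bijective. -/
  bijective : Function.Bijective
    (TensorProduct.lift
      (LinearMap.mk₂ F (fun (l : L) (h : H) => (l • act h : Module.End F L))
        (fun l l' h => add_smul l l' (act h))
        (fun c l h => smul_assoc c l (act h))
        (fun l h h' => by rw [map_add, smul_add])
        (fun c l h => by rw [map_smul, smul_comm])) :
      L ⊗[F] H →ₗ[F] Module.End F L)

attribute [instance] HopfGaloisStructure.instRing HopfGaloisStructure.instHopfAlgebra

section GreitherPareigis

variable {F : Type u} {L : Type v} [Field F] [Field L] [Algebra F L]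

/-- The action of `g ∈ G = Gal(L/F)` on the group algebra `L[N]`: as a Galois automorphism on the
coefficients, and by `η ↦ λ(g) η λ(g)⁻¹` on `N`. -/
noncomputable def groupAlgebraAct {N : Subgroup (Equiv.Perm Gal(L/F))}
    (hN : IsNormalizedByLeftReg N) (g : Gal(L/F)) :
    MonoidAlgebra L N →ₐ[F] MonoidAlgebra L N :=
  (MonoidAlgebra.domCongr F L (twistedConj hN g)).toAlgHom.comp
    (MonoidAlgebra.mapAlgHom N g.toAlgHom)

/-- The fixed ring `L[N]^G`, an `F`-algebra. -/
noncomputable def fixedRing {N : Subgroup (Equiv.Perm Gal(L/F))}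
    (hN : IsNormalizedByLeftReg N) : Subalgebra F (MonoidAlgebra L N) :=
  ⨅ g : Gal(L/F), AlgHom.equalizer (groupAlgebraAct hN g) (AlgHom.id F (MonoidAlgebra L N))

namespace HopfGaloisStructure

/-- Two Hopf–Galois structures on `L/F` are identified if there is an isomorphism of `F`-Hopf
algebras between them that respects the actions on `L`. (A bialgebra isomorphism of Hopf algebras
automatically respects the antipodes.) -/
def Equivalent (S T : HopfGaloisStructure F L) : Prop :=
  ∃ e : S.H ≃ₐc[F] T.H, ∀ h : S.H, T.act (e h) = S.act h

/-- `N` is the underlying group of the Hopf–Galois structure `S`: `N` is a regular subgroup of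
`Perm(G)`, `G = Gal(L/F)`, normalised by `λ(G)`, and `S` is the structure given by the Hopf
algebra `L[N]^G`. That is, there is an isomorphism of `F`-algebras `φ : H ≃ L[N]^G` under which
the comultiplication and counit of `H` are the restrictions of those of the `L`-Hopf algebra
`L[N]`, and the action of `H` on `L` is the action of `L[N]^G` on `L` in the Greither–Pareigis
correspondence, `(∑ c_η η)(x) = ∑ c_η · (η⁻¹(1_G))(x)`. -/
def HasUnderlyingGroup (S : HopfGaloisStructure F L) (N : Subgroup (Equiv.Perm Gal(L/F))) :
    Prop :=
  IsRegularSubgroup N ∧ ∃ hN : IsNormalizedByLeftReg N, ∃ φ : S.H ≃ₐ[F] fixedRing hN,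
    (∀ h : S.H,
      Coalgebra.comul (R := L) (φ h : MonoidAlgebra L N) =
        TensorProduct.mapOfCompatibleSMul L F L (MonoidAlgebra L N) (MonoidAlgebra L N)
          (TensorProduct.map ((fixedRing hN).val.comp φ.toAlgHom).toLinearMap
            ((fixedRing hN).val.comp φ.toAlgHom).toLinearMap (Coalgebra.comul (R := F) h))) ∧
    (∀ h : S.H,
      Coalgebra.counit (R := L) (φ h : MonoidAlgebra L N) =
        algebraMap F L (Coalgebra.counit (R := F) h)) ∧
    (∀ (h : S.H) (x : L),
      S.act h x = (φ h : MonoidAlgebra L N).coeff.sum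
        fun η c => c * ((η : Equiv.Perm Gal(L/F))⁻¹ 1) x)

/-- `S` is of type `M`: its underlying group is isomorphic to `M`. -/
def IsOfType (S : HopfGaloisStructure F L) (M : Type*) [Group M] : Prop :=
  ∃ N : Subgroup (Equiv.Perm Gal(L/F)), S.HasUnderlyingGroup N ∧ Nonempty (N ≃* M)

end HopfGaloisStructure

end GreitherPareigis

/-! The argument combines the Greither–Pareigis dictionary with a classification of regular
subgroups of exponent two.

By Galois descent, `L[N]^G` is an `F`-form of `L[N]` (`isForm_fixedRing`): some `F`-basis of it is
an `L`-basis of `L[N]`. The comultiplication, counit and antipode of `L[N]` commute with the Galois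
action and so restrict to `L[N]^G`, and each Hopf identity can be checked in `L[N]`. Dedekind
independence of automorphisms and regularity of `N` make `L[N] → End_F(L)` bijective
(`galAction_bijective`), so `L[N]^G` is a Hopf–Galois structure (`ofRegular`). Such a structure
determines `N` as a set of permutations (`HasUnderlyingGroup.unique`), and `N` determines it up to
equivalence (`HasUnderlyingGroup.equivalent`).

What remains is to find the regular `N` of exponent two normalised by `λ(G)`. The 2-group `G` acts
on `N` by conjugation, fixing `1` and hence some other element. Commuting with `λ(G)`, this is right
multiplication by an involution, and the only involution of `G` is the central `z`; so `λ(z) ∈ N`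
(`leftReg_z_mem`). Let `n, m ∈ N` send `1` to `s` and to `t`. Regularity forces `n t` to be `st` or
`z st`, and either value determines `N` (`groupE_le`, `eq_groupE_or`). The two cases give the two
groups `E`. -/

/-! ### Galois descent for semilinear actions -/

section Descent

variable {F L V : Type*} [Field F] [Field L] [Algebra F L]
  [AddCommGroup V] [Module F V] [Module L V]

/-- Vectors fixed by a semilinear Galois action which are linearly independent over the base field
remain so over the extension. -/
theorem linearIndependent_of_fixed [FiniteDimensional F L] [IsGalois F L] 
    [IsScalarTower F L V] (act : Gal(L/F) → V →ₗ[F] V) (hact : ∀ g (l : L) v, act g (l • v) = g l • act g v)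
    {ι : Type*} {h : ι → V} (hfix : ∀ g i, act g (h i) = h i) (hli : LinearIndependent F h) :
    LinearIndependent L h := by
  rw [linearIndependent_iff'] at hli ⊢
  intro s c hc i hi
  -- Multiplying the relation by `l` and summing its conjugates gives a relation over `F` with
  -- coefficients `Tr(c i * l)`. These vanish for every `l`, and the trace form is nondegenerate.
  refine (traceForm_nondegenerate F L).1 (c i) fun l => ?_
  rw [Algebra.traceForm_apply]
  refine hli s (fun i => Algebra.trace F L (c i * l)) ?_ i hi
  have key : ∀ i, Algebra.trace F L (c i * l) • h i = ∑ g : Gal(L/F), act g (l • c i • h i) := by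
    intro i
    rw [← algebraMap_smul L, trace_eq_sum_automorphisms, Finset.sum_smul]
    refine Finset.sum_congr rfl fun g _ => ?_
    rw [smul_smul, hact, hfix, mul_comm]
  simp only [key]
  rw [Finset.sum_comm]
  refine Finset.sum_eq_zero fun g _ => ?_
  rw [← map_sum, ← Finset.smul_sum, hc, smul_zero, map_zero]

/-- The automorphisms of a field extension are linearly independent as maps. -/
theorem linearIndependent_gal :
    LinearIndependent L (fun (g : Gal(L/F)) (x : L) => g x) := by
  have hinj : Function.Injective (fun g : Gal(L/F) => ((g : L →ₐ[F] L) : L →* L)) := by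
    intro g k hgk
    ext x
    exact DFunLike.congr_fun hgk x
  exact (linearIndependent_monoidHom L L).comp _ hinj

/-- The vectors fixed by a semilinear Galois action span the space. -/
theorem span_fixed_eq_top [FiniteDimensional F L] (act : Gal(L/F) → V →ₗ[F] V)
    (hact : ∀ g (l : L) v, act g (l • v) = g l • act g v)
    (hone : ∀ v, act 1 v = v) (hmul : ∀ g h v, act (g * h) v = act g (act h v)) :
    Submodule.span L {v | ∀ g, act g v = v} = ⊤ := by
  by_contra hne
  -- A functional `f` killing all fixed vectors kills the trace of `l • v` for every `l`. This is a
  -- linear relation among the automorphisms, so each coefficient `f (act g v)` is zero; `g = 1`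
  -- gives `f v = 0`.
  obtain ⟨f, hf0, hf⟩ := Submodule.exists_le_ker_of_lt_top _ (lt_top_iff_ne_top.2 hne)
  refine hf0 (LinearMap.ext fun v => ?_)
  have hsum : ∀ l : L, ∑ g : Gal(L/F), f (act g v) * g l = 0 := by
    intro l
    have hmem : (∑ g : Gal(L/F), act g (l • v)) ∈ LinearMap.ker f := by
      refine hf (Submodule.subset_span fun k => ?_)
      rw [map_sum]
      simp only [← hmul]
      exact Fintype.sum_equiv (Equiv.mulLeft k) _ _ fun g => rfl
    rw [LinearMap.mem_ker, map_sum] at hmem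
    simpa [hact, mul_comm] using hmem
  have h1 := Fintype.linearIndependent_iff.1 (linearIndependent_gal (F := F) (L := L))
    (fun g => f (act g v)) (by
      funext l
      simpa using hsum l) 1
  simpa [hone] using h1

end Descent

/-! ### Forms of `L`-spaces over `F` -/

section Form

variable {F L A B V W : Type*} [Field F] [Field L] [Algebra F L]
  [AddCommMonoid A] [Module F A] [AddCommMonoid B] [Module F B]
  [AddCommMonoid V] [Module F V] [Module L V] [AddCommMonoid W] [Module F W] [Module L W]

/-- `f` exhibits the `F`-space `A` as a form of the finite-dimensional `L`-space `V`: it takes some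
`F`-basis of `A` to an `L`-basis of `V`. -/
def IsForm (L : Type*) [Field L] [Module L V] (f : A →ₗ[F] V) : Prop :=
  ∃ (n : ℕ) (a : Module.Basis (Fin n) F A) (v : Module.Basis (Fin n) L V), ∀ i, f (a i) = v i

/-- In the matching bases `f` is the inclusion of coordinates `F ⊆ L`. Through this lemma,
identities over `F` are verified after passing to `L`. -/
theorem IsForm.injective [IsScalarTower F L V] {f : A →ₗ[F] V} (hf : IsForm L f) : Function.Injective f := by
  obtain ⟨n, a, v, h⟩ := hf
  have key : ∀ x i, v.repr (f x) i = algebraMap F L (a.repr x i) := by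
    intro x i
    conv_lhs => rw [← a.sum_repr x, map_sum]
    have : ∀ j, f (a.repr x j • a j) = algebraMap F L (a.repr x j) • v j := by
      intro j
      rw [map_smul, h, algebraMap_smul]
    simp only [this]
    rw [v.repr_sum_self]
  intro x y hxy
  refine a.ext_elem fun i => (algebraMap F L).injective ?_
  rw [← key, ← key, hxy]

/-- The map `A ⊗ B → V ⊗ W` induced by `F`-linear maps `A → V` and `B → W` into `L`-spaces. -/
noncomputable def tensorForm [IsScalarTower F L V] [IsScalarTower F L W]
    (f : A →ₗ[F] V) (g : B →ₗ[F] W) : A ⊗[F] B →ₗ[F] V ⊗[L] W :=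
  (TensorProduct.mapOfCompatibleSMul L F L V W).restrictScalars F ∘ₗ TensorProduct.map f g

@[simp]
theorem tensorForm_tmul [IsScalarTower F L V] [IsScalarTower F L W] (f : A →ₗ[F] V) (g : B →ₗ[F] W)
    (a : A) (b : B) :
    tensorForm (L := L) f g (a ⊗ₜ b) = f a ⊗ₜ g b := rfl

theorem IsForm.tensorForm [IsScalarTower F L V] [IsScalarTower F L W]
    {f : A →ₗ[F] V} {g : B →ₗ[F] W}
    (hf : IsForm L f) (hg : IsForm L g) :
    IsForm L (tensorForm (L := L) f g) := by
  obtain ⟨n, a, v, hv⟩ := hf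
  obtain ⟨m, b, w, hw⟩ := hg
  refine ⟨n * m, (a.tensorProduct b).reindex finProdFinEquiv,
    (v.tensorProduct w).reindex finProdFinEquiv, fun i => ?_⟩
  simp [Module.Basis.tensorProduct_apply', hv, hw]

/-- The extension `j` carries the base change of one basis to the other basis. -/
theorem IsForm.bijective_lift {f : A →ₗ[F] V} (hf : IsForm L f)
    (j : L ⊗[F] A →ₗ[L] V) (hj : ∀ a, j (1 ⊗ₜ a) = f a) : Function.Bijective j := by
  obtain ⟨n, a, v, hv⟩ := hf
  have : j = ((a.baseChange L).equiv v (Equiv.refl _)).toLinearMap := by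
    refine (a.baseChange L).ext fun i => ?_
    rw [Module.Basis.baseChange_apply, hj, hv, LinearEquiv.coe_coe,
      ← Module.Basis.baseChange_apply, Module.Basis.equiv_apply, Equiv.refl_apply]
  rw [this]
  exact LinearEquiv.bijective _

end Form

/-! ### The semilinear action on `L[N]` and its fixed ring -/

section GroupAlgebra

variable {F : Type u} {L : Type v} [Field F] [Field L] [Algebra F L]
  {N : Subgroup (Equiv.Perm Gal(L/F))}

open MonoidAlgebra

theorem twistedConj_coe {G : Type*} [Group G] {N : Subgroup (Equiv.Perm G)}
    (hN : IsNormalizedByLeftReg N) (g : G) (η : N) :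
    (twistedConj hN g η : Equiv.Perm G) = leftReg g * η * (leftReg g)⁻¹ := rfl

theorem twistedConj_mul {G : Type*} [Group G] {N : Subgroup (Equiv.Perm G)}
    (hN : IsNormalizedByLeftReg N) (g h : G) (η : N) :
    twistedConj hN (g * h) η = twistedConj hN g (twistedConj hN h η) := by
  ext1
  simp [twistedConj_coe, mul_assoc]

theorem twistedConj_one {G : Type*} [Group G] {N : Subgroup (Equiv.Perm G)}
    (hN : IsNormalizedByLeftReg N) (η : N) : twistedConj hN 1 η = η := by
  ext1
  simp [twistedConj_coe]

@[simp]
theorem groupAlgebraAct_single (hN : IsNormalizedByLeftReg N) (g : Gal(L/F)) (η : N) (c : L) :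
    groupAlgebraAct hN g (single η c) = single (twistedConj hN g η) (g c) := by
  simp [groupAlgebraAct]

theorem groupAlgebraAct_smul (hN : IsNormalizedByLeftReg N) (g : Gal(L/F)) (l : L)
    (x : MonoidAlgebra L N) : groupAlgebraAct hN g (l • x) = g l • groupAlgebraAct hN g x := by
  induction x using MonoidAlgebra.induction_linear with
  | zero => simp
  | add x y hx hy => simp [smul_add, hx, hy]
  | single η c => simp

theorem groupAlgebraAct_mul (hN : IsNormalizedByLeftReg N) (g h : Gal(L/F))
    (x : MonoidAlgebra L N) :
    groupAlgebraAct hN (g * h) x = groupAlgebraAct hN g (groupAlgebraAct hN h x) := by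
  induction x using MonoidAlgebra.induction_linear with
  | zero => simp
  | add x y hx hy => simp [hx, hy]
  | single η c => simp [twistedConj_mul]

theorem groupAlgebraAct_one (hN : IsNormalizedByLeftReg N) (x : MonoidAlgebra L N) :
    groupAlgebraAct hN 1 x = x := by
  induction x using MonoidAlgebra.induction_linear with
  | zero => simp
  | add x y hx hy => simp [hx, hy]
  | single η c => simp [twistedConj_one]

theorem mem_fixedRing (hN : IsNormalizedByLeftReg N) (x : MonoidAlgebra L N) :
    x ∈ fixedRing hN ↔ ∀ g, groupAlgebraAct hN g x = x := by
  simp [fixedRing, Algebra.mem_iInf, AlgHom.mem_equalizer]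

theorem coeff_groupAlgebraAct (hN : IsNormalizedByLeftReg N) (g : Gal(L/F)) (η : N)
    (x : MonoidAlgebra L N) :
    (groupAlgebraAct hN g x).coeff (twistedConj hN g η) = g (x.coeff η) := by
  simp [groupAlgebraAct]

theorem coeff_of_mem_fixedRing {hN : IsNormalizedByLeftReg N} {x : MonoidAlgebra L N}
    (hx : x ∈ fixedRing hN) (g : Gal(L/F)) (η : N) :
    x.coeff (twistedConj hN g η) = g (x.coeff η) := by
  rw [← coeff_groupAlgebraAct hN, (mem_fixedRing hN x).1 hx]

theorem sum_coeff_smul {M : Type*} [Fintype M] (x : MonoidAlgebra L M) :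
    ∑ η : M, x.coeff η • single η (1 : L) = x := by
  ext η
  simp [MonoidAlgebra.coeff_sum]

variable [FiniteDimensional F L]

/-- The basis of the group algebra given by the group elements. -/
noncomputable def groupAlgebraBasis (L : Type*) [Field L] (M : Type*) :
    Module.Basis M L (MonoidAlgebra L M) := .ofRepr (MonoidAlgebra.coeffLinearEquiv L)

theorem span_fixedRing [IsGalois F L] (hN : IsNormalizedByLeftReg N) :
    Submodule.span L (fixedRing hN : Set (MonoidAlgebra L N)) = ⊤ := by
  have := span_fixed_eq_top (V := MonoidAlgebra L N)
    (fun g : Gal(L/F) => (groupAlgebraAct hN g).toLinearMap)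
    (groupAlgebraAct_smul hN) (groupAlgebraAct_one hN) (groupAlgebraAct_mul hN)
  rw [← this]
  congr 1
  ext x
  simp [mem_fixedRing]

/-- Any `F`-basis of the fixed ring works: descent of independence and the spanning theorem make it
an `L`-basis of `L[N]`. -/
theorem isForm_fixedRing [IsGalois F L] (hN : IsNormalizedByLeftReg N) :
    IsForm L (fixedRing hN).val.toLinearMap := by
  have : Finite N := inferInstance
  have : Module.Finite L (MonoidAlgebra L N) := .of_basis (groupAlgebraBasis L N)
  let b := Module.Basis.ofVectorSpace F (fixedRing hN)
  have hli : LinearIndependent L (fun i => (b i : MonoidAlgebra L N)) :=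
    linearIndependent_of_fixed (fun g : Gal(L/F) => (groupAlgebraAct hN g).toLinearMap)
      (groupAlgebraAct_smul hN) (fun g i => (mem_fixedRing hN _).1 (b i).2 g)
      (b.linearIndependent.map' (fixedRing hN).val.toLinearMap
        (LinearMap.ker_eq_bot.2 Subtype.val_injective))
  have hsp : ⊤ ≤ Submodule.span L (Set.range fun i => (b i : MonoidAlgebra L N)) := by
    rw [← span_fixedRing hN, Submodule.span_le]
    intro x hx
    have := congrArg (fixedRing hN).val (b.linearCombination_repr ⟨x, hx⟩)
    rw [Finsupp.linearCombination_apply, Finsupp.sum, map_sum] at this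
    simp only [map_smul, Subalgebra.coe_val] at this
    rw [SetLike.mem_coe, ← this]
    refine Submodule.sum_mem _ fun i _ => ?_
    rw [← algebraMap_smul L]
    exact Submodule.smul_mem _ _ (Submodule.subset_span ⟨i, rfl⟩)
  let v := Module.Basis.mk hli hsp
  have := Module.Finite.finite_basis v
  have e := Finite.equivFin (Module.Basis.ofVectorSpaceIndex F (fixedRing hN))
  refine ⟨_, b.reindex e, v.reindex e, fun i => ?_⟩
  rw [Module.Basis.reindex_apply, Module.Basis.reindex_apply, Module.Basis.mk_apply]
  rfl

end GroupAlgebra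

/-! ### Descent of the comultiplication, and the action of `L[N]` on `L` -/

section GaloisAction

variable {F : Type u} {L : Type v} [Field F] [Field L] [Algebra F L]
  {N : Subgroup (Equiv.Perm Gal(L/F))}

open MonoidAlgebra

theorem comul_groupAlgebra {M : Type*} [Fintype M] (x : MonoidAlgebra L M) :
    Coalgebra.comul (R := L) x =
      ∑ η : M, x.coeff η • (single η (1 : L) ⊗ₜ[L] single η (1 : L)) := by
  conv_lhs => rw [← sum_coeff_smul x]
  simp only [map_sum, map_smul, comul_single, CommSemiring.comul_apply, TensorProduct.map_tmul,
    lsingle_apply]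

theorem counit_groupAlgebra {M : Type*} [Fintype M] (x : MonoidAlgebra L M) :
    Coalgebra.counit (R := L) x = ∑ η : M, x.coeff η := by
  conv_lhs => rw [← sum_coeff_smul x]
  simp [map_sum]

theorem mem_range_algebraMap_of_fixed [FiniteDimensional F L] [IsGalois F L] {l : L}
    (h : ∀ g : Gal(L/F), g l = l) :   l ∈ Set.range (algebraMap F L) :=
  (IsGalois.mem_range_algebraMap_iff_fixed l).2 h

/-- The comultiplication of `L[N]` takes `L[N]^G` to `L[N]^G ⊗ L[N]^G`. -/
theorem exists_comul_fixedRing [FiniteDimensional F L] [IsGalois F L] (hN : IsNormalizedByLeftReg N)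
    (h : fixedRing hN) :
    ∃ t : fixedRing hN ⊗[F] fixedRing hN,
      tensorForm (L := L) (fixedRing hN).val.toLinearMap (fixedRing hN).val.toLinearMap t =
        Coalgebra.comul (R := L) (h : MonoidAlgebra L N) := by
  have := Fintype.ofFinite N
  obtain ⟨n, a, v, hv⟩ := isForm_fixedRing hN
  -- Since the basis vectors `v i` are fixed, coordinates are Galois equivariant.
  have hrepr : ∀ (g : Gal(L/F)) (η : N) (i : Fin n),
      v.repr (single (twistedConj hN g η) 1) i = g (v.repr (single η 1) i) := by
    intro g η i
    have h1 : single (twistedConj hN g η) (1 : L) = ∑ j, g (v.repr (single η 1) j) • v j := by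
      have h2 := groupAlgebraAct_single hN g η 1
      rw [map_one] at h2
      rw [← h2]
      conv_lhs => rw [← v.sum_repr (single η 1)]
      rw [map_sum]
      refine Finset.sum_congr rfl fun j _ => ?_
      rw [groupAlgebraAct_smul, ← hv]
      congr 1
      exact (mem_fixedRing hN _).1 (a j).2 g
    rw [h1, v.repr_sum_self]
  -- These are the coordinates of `∑ h_η (η ⊗ η)` in the basis `v i ⊗ v j`. Applying `g` only
  -- permutes the summands, so they lie in `F`.
  let c : Fin n → Fin n → L := fun i j => ∑ η : N, (h : MonoidAlgebra L N).coeff η *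
    (v.repr (single η 1) i * v.repr (single η 1) j)
  have hc : ∀ i j, ∃ d : F, algebraMap F L d = c i j := by
    intro i j
    refine mem_range_algebraMap_of_fixed fun g => ?_
    simp only [c, map_sum, map_mul, ← hrepr, ← coeff_of_mem_fixedRing h.2]
    exact Equiv.sum_comp (twistedConj hN g).toEquiv (fun η => (h : MonoidAlgebra L N).coeff η *
      (v.repr (single η 1) i * v.repr (single η 1) j))
  choose d hd using hc
  refine ⟨∑ i, ∑ j, d i j • (a i ⊗ₜ a j), ?_⟩
  simp only [map_sum, map_smul, tensorForm_tmul, hv]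
  have h2 : ∀ i j, d i j • (v i ⊗ₜ[L] v j) = c i j • (v i ⊗ₜ[L] v j) := by
    intro i j
    rw [← hd, algebraMap_smul]
  simp only [h2, c, Finset.sum_smul]
  rw [comul_groupAlgebra]
  have h3 : ∀ η : N, single η (1 : L) ⊗ₜ[L] single η (1 : L) = ∑ i, ∑ j,
      (v.repr (single η 1) i * v.repr (single η 1) j) • (v i ⊗ₜ[L] v j) := by
    intro η
    conv_lhs => rw [← v.sum_repr (single η 1)]
    simp only [TensorProduct.sum_tmul, TensorProduct.tmul_sum, TensorProduct.smul_tmul_smul]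
    exact Finset.sum_comm
  simp only [h3, Finset.smul_sum, smul_smul]
  symm
  rw [Finset.sum_comm]
  exact Finset.sum_congr rfl fun i _ => Finset.sum_comm

/-- The `L`-linear map `L[N] → End_F(L)` taking `η` to `η⁻¹(1)`. -/
noncomputable def galAction (F : Type u) (L : Type v) [Field F] [Field L] [Algebra F L]
    (N : Subgroup (Equiv.Perm Gal(L/F))) : MonoidAlgebra L N →ₗ[L] Module.End F L :=
  (Finsupp.linearCombination L fun η : N =>
      (((η : Equiv.Perm Gal(L/F))⁻¹ 1 : Gal(L/F)) : L →ₗ[F] L)) ∘ₗ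
    (MonoidAlgebra.coeffLinearEquiv L).toLinearMap

theorem galAction_apply (x : MonoidAlgebra L N) (y : L) :
    galAction F L N x y =
      x.coeff.sum fun η c => c * ((η : Equiv.Perm Gal(L/F))⁻¹ 1) y := by
  simp [galAction, Finsupp.linearCombination_apply, Finsupp.sum]

@[simp]
theorem galAction_single (η : N) (c y : L) :
    galAction F L N (single η c) y = c * ((η : Equiv.Perm Gal(L/F))⁻¹ 1) y := by
  simp [galAction_apply]

/-- If two elements `η`, `θ` have the same value, then `θη⁻¹` fixes `1`. -/
theorem IsRegularSubgroup.injective_inv_apply_one {G : Type*} [Group G]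
    {N : Subgroup (Equiv.Perm G)} (hreg : IsRegularSubgroup N) :
    Function.Injective fun η : N => (η : Equiv.Perm G)⁻¹ 1 := by
  intro η θ h
  have h1 := hreg.stabilizer_trivial 1 (θ * η⁻¹ : N) (θ * η⁻¹ : N).2 (by
    simp only [Subgroup.coe_mul, Subgroup.coe_inv, Equiv.Perm.mul_apply]
    exact (congrArg (θ : Equiv.Perm G) h).trans (by simp))
  ext1
  exact (mul_inv_eq_one.1 h1).symm

theorem galAction_injective (hreg : IsRegularSubgroup N) :
    Function.Injective (galAction F L N) := by
  have hli : LinearIndependent L fun η : N =>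
      (((η : Equiv.Perm Gal(L/F))⁻¹ 1 : Gal(L/F)) : L →ₗ[F] L) := by
    refine LinearIndependent.of_comp
      (f := ({ toFun := fun φ x => φ x, map_add' := fun _ _ => rfl, map_smul' := fun _ _ => rfl } :
        (L →ₗ[F] L) →ₗ[L] (L → L))) ?_
    exact (linearIndependent_gal (F := F) (L := L)).comp _ hreg.injective_inv_apply_one
  exact Function.Injective.comp (g := Finsupp.linearCombination L _) hli
    (MonoidAlgebra.coeffLinearEquiv L).injective

/-- Injectivity suffices by dimension over `L`: `|N| = |G| = [L:F] = dim_L End_F(L)`. -/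
theorem galAction_bijective [FiniteDimensional F L] [IsGalois F L] (hreg : IsRegularSubgroup N) :
    Function.Bijective (galAction F L N) := by
  have := Fintype.ofFinite N
  have : Module.Finite L (MonoidAlgebra L N) := .of_basis (groupAlgebraBasis L N)
  have hinj := galAction_injective (F := F) (L := L) hreg
  refine ⟨hinj, (LinearMap.injective_iff_surjective_of_finrank_eq_finrank ?_).1 hinj⟩
  rw [Module.finrank_eq_card_basis (groupAlgebraBasis L N), ← Nat.card_eq_fintype_card,
    hreg.card_eq, IsGalois.card_aut_eq_finrank]
  exact (Module.finrank_linearMap_self F L L).symm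

/-- For `η` acting as `g = η⁻¹(1)`, moving `g` past the coefficients of `y` is compensated by
conjugating `N` by `λ(g)`. Hence the right factor has to be fixed, while the left one is arbitrary.
-/
theorem galAction_mul [FiniteDimensional F L] (hN : IsNormalizedByLeftReg N) 
    (x y : MonoidAlgebra L N) (hy : y ∈ fixedRing hN) :
    galAction F L N (x * y) = galAction F L N x * galAction F L N y := by
  ext z
  induction x using MonoidAlgebra.induction_linear with
  | zero => simp
  | add x x' hx hx' => simp [add_mul, hx, hx']
  | single η c =>
    have := Fintype.ofFinite N
    have h1 : ∀ w : MonoidAlgebra L N, galAction F L N w z =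
        ∑ θ : N, w.coeff θ * ((θ : Equiv.Perm Gal(L/F))⁻¹ 1) z := by
      intro w
      rw [galAction_apply, Finsupp.sum_fintype _ _ (by simp)]
    set g : Gal(L/F) := (η : Equiv.Perm Gal(L/F))⁻¹ 1 with hg
    rw [Module.End.mul_apply, galAction_single, h1 y, map_sum, Finset.mul_sum]
    conv_lhs => rw [← sum_coeff_smul y, Finset.mul_sum]
    simp only [map_sum, LinearMap.sum_apply]
    -- With `θ` replaced by `λ(g)θλ(g)⁻¹`, the sums match termwise, because `(η λ(g)θλ(g)⁻¹)⁻¹(1) =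
    -- g · θ⁻¹(1)`.
    rw [← Equiv.sum_comp (twistedConj hN g).toEquiv]
    refine Finset.sum_congr rfl fun θ _ => ?_
    simp only [MulEquiv.toEquiv_eq_coe, MulEquiv.coe_toEquiv, coeff_of_mem_fixedRing hy]
    rw [smul_single, single_mul_single, galAction_single]
    simp only [smul_eq_mul, mul_one, map_mul]
    rw [mul_assoc]
    congr 2
    rw [← AlgEquiv.mul_apply]
    congr 1
    have h2 : (Equiv.symm (η : Equiv.Perm Gal(L/F))) 1 = g := rfl
    simp [twistedConj_coe, mul_assoc, leftReg, h2]

end GaloisAction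

/-! ### The Hopf algebra structure on `L[N]^G` -/

section FixedRingHopf

variable {F : Type u} {L : Type v} [Field F] [Field L] [Algebra F L]
  {N : Subgroup (Equiv.Perm Gal(L/F))} (hN : IsNormalizedByLeftReg N)

open MonoidAlgebra

/-- The inclusion of `L[N]^G` in `L[N]`. -/
noncomputable abbrev fixedRingVal : fixedRing hN →ₗ[F] MonoidAlgebra L N :=
  (fixedRing hN).val.toLinearMap

/-- The map `L[N]^G ⊗_F L[N]^G → L[N] ⊗_L L[N]`. -/
noncomputable abbrev fixedRingVal₂ :
    fixedRing hN ⊗[F] fixedRing hN →ₗ[F] MonoidAlgebra L N ⊗[L] MonoidAlgebra L N :=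
  tensorForm (fixedRingVal hN) (fixedRingVal hN)

theorem fixedRingVal₂_mul (s t : fixedRing hN ⊗[F] fixedRing hN) :
    fixedRingVal₂ hN (s * t) = fixedRingVal₂ hN s * fixedRingVal₂ hN t := by
  induction s with
  | zero => simp only [zero_mul, map_zero]
  | add x y hx hy => simp only [add_mul, map_add, hx, hy]
  | tmul a b =>
    induction t with
    | zero => simp only [mul_zero, map_zero]
    | add x y hx hy => simp only [mul_add, map_add, hx, hy]
    | tmul c d => simp [Algebra.TensorProduct.tmul_mul_tmul]

theorem groupAlgebraAct_antipode (g : Gal(L/F)) (x : MonoidAlgebra L N) :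
    groupAlgebraAct hN g (HopfAlgebra.antipode L x) =
      HopfAlgebra.antipode L (groupAlgebraAct hN g x) := by
  induction x using MonoidAlgebra.induction_linear with
  | zero => simp only [map_zero]
  | add x y hx hy => simp only [map_add, hx, hy]
  | single η c => simp

variable [FiniteDimensional F L] [IsGalois F L]

/-- This makes the descended comultiplication unique, whence its linearity and the bialgebra axioms.
-/
theorem fixedRingVal₂_injective : Function.Injective (fixedRingVal₂ hN) :=
  ((isForm_fixedRing hN).tensorForm (isForm_fixedRing hN)).injective

/-- The comultiplication of `L[N]^G`. -/
noncomputable def fixedRingComul : fixedRing hN →ₗ[F] fixedRing hN ⊗[F] fixedRing hN where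
  toFun h := (exists_comul_fixedRing hN h).choose
  map_add' x y := fixedRingVal₂_injective hN <| by
    rw [map_add, (exists_comul_fixedRing hN _).choose_spec,
      (exists_comul_fixedRing hN _).choose_spec, (exists_comul_fixedRing hN _).choose_spec,
      Subalgebra.coe_add, map_add]
  map_smul' c x := fixedRingVal₂_injective hN <| by
    rw [map_smul, (exists_comul_fixedRing hN _).choose_spec, RingHom.id_apply,
      (exists_comul_fixedRing hN _).choose_spec, Subalgebra.coe_smul, ← algebraMap_smul L, map_smul,
      algebraMap_smul]

theorem fixedRingVal₂_comul (h : fixedRing hN) :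
    fixedRingVal₂ hN (fixedRingComul hN h) = Coalgebra.comul (R := L) (h : MonoidAlgebra L N) :=
  (exists_comul_fixedRing hN h).choose_spec

theorem exists_counit_fixedRing (h : fixedRing hN) :
    ∃ c : F, algebraMap F L c = Coalgebra.counit (R := L) (h : MonoidAlgebra L N) := by
  have := Fintype.ofFinite N
  refine mem_range_algebraMap_of_fixed fun g => ?_
  simp only [counit_groupAlgebra, map_sum, ← coeff_of_mem_fixedRing h.2]
  exact Equiv.sum_comp (twistedConj hN g).toEquiv (fun η => (h : MonoidAlgebra L N).coeff η)

/-- The counit of `L[N]^G`. -/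
noncomputable def fixedRingCounit : fixedRing hN →ₗ[F] F where
  toFun h := (exists_counit_fixedRing hN h).choose
  map_add' x y := (algebraMap F L).injective <| by
    rw [map_add, (exists_counit_fixedRing hN _).choose_spec,
      (exists_counit_fixedRing hN _).choose_spec, (exists_counit_fixedRing hN _).choose_spec,
      Subalgebra.coe_add, map_add]
  map_smul' c x := (algebraMap F L).injective <| by
    rw [smul_eq_mul, map_mul, (exists_counit_fixedRing hN _).choose_spec, RingHom.id_apply,
      (exists_counit_fixedRing hN _).choose_spec, Subalgebra.coe_smul, ← algebraMap_smul L,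
      map_smul, smul_eq_mul]

theorem algebraMap_fixedRingCounit (h : fixedRing hN) :
    algebraMap F L (fixedRingCounit hN h) = Coalgebra.counit (R := L) (h : MonoidAlgebra L N) :=
  (exists_counit_fixedRing hN h).choose_spec

/-- This and the next three lemmas carry the two sides of the coalgebra axioms over to `L[N]`, where
the axioms are known. -/
theorem fixedRing_coassoc_left (t : fixedRing hN ⊗[F] fixedRing hN) :
    tensorForm (fixedRingVal hN) (fixedRingVal₂ hN) (TensorProduct.assoc F _ _ _
      ((fixedRingComul hN).rTensor _ t)) =
    TensorProduct.assoc L _ _ _ ((Coalgebra.comul (R := L)).rTensor _ (fixedRingVal₂ hN t)) := by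
  induction t with
  | zero => simp only [map_zero]
  | add x y hx hy => simp only [map_add, hx, hy]
  | tmul a b =>
    have key : ∀ s : fixedRing hN ⊗[F] fixedRing hN,
        tensorForm (fixedRingVal hN) (fixedRingVal₂ hN) (TensorProduct.assoc F _ _ _ (s ⊗ₜ b)) =
        TensorProduct.assoc L _ _ _ (fixedRingVal₂ hN s ⊗ₜ (b : MonoidAlgebra L N)) := by
      intro s
      induction s with
      | zero => simp only [TensorProduct.zero_tmul, map_zero]
      | add x y hx hy => simp only [TensorProduct.add_tmul, map_add, hx, hy]
      | tmul x y => rfl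
    rw [LinearMap.rTensor_tmul, key, fixedRingVal₂_comul]
    rfl

theorem fixedRing_coassoc_right (t : fixedRing hN ⊗[F] fixedRing hN) :
    tensorForm (fixedRingVal hN) (fixedRingVal₂ hN) ((fixedRingComul hN).lTensor _ t) =
      (Coalgebra.comul (R := L)).lTensor _ (fixedRingVal₂ hN t) := by
  induction t with
  | zero => simp only [map_zero]
  | add x y hx hy => simp only [map_add, hx, hy]
  | tmul a b =>
    rw [LinearMap.lTensor_tmul, tensorForm_tmul, fixedRingVal₂_comul]
    rfl

theorem fixedRing_counit_left (t : fixedRing hN ⊗[F] fixedRing hN) :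
    fixedRingVal hN (TensorProduct.lid F _ ((fixedRingCounit hN).rTensor _ t)) =
      TensorProduct.lid L _ ((Coalgebra.counit (R := L)).rTensor _ (fixedRingVal₂ hN t)) := by
  induction t with
  | zero => simp only [map_zero]
  | add x y hx hy => simp only [map_add, hx, hy]
  | tmul a b =>
    rw [LinearMap.rTensor_tmul, TensorProduct.lid_tmul, tensorForm_tmul, LinearMap.rTensor_tmul,
      TensorProduct.lid_tmul, map_smul, ← algebraMap_smul L, algebraMap_fixedRingCounit]
    rfl

theorem fixedRing_counit_right (t : fixedRing hN ⊗[F] fixedRing hN) :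
    fixedRingVal hN (TensorProduct.rid F _ ((fixedRingCounit hN).lTensor _ t)) =
      TensorProduct.rid L _ ((Coalgebra.counit (R := L)).lTensor _ (fixedRingVal₂ hN t)) := by
  induction t with
  | zero => simp only [map_zero]
  | add x y hx hy => simp only [map_add, hx, hy]
  | tmul a b =>
    rw [LinearMap.lTensor_tmul, TensorProduct.rid_tmul, tensorForm_tmul, LinearMap.lTensor_tmul,
      TensorProduct.rid_tmul, map_smul, ← algebraMap_smul L, algebraMap_fixedRingCounit]
    rfl

noncomputable instance fixedRing.instCoalgebra : Coalgebra F (fixedRing hN) where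
  comul := fixedRingComul hN
  counit := fixedRingCounit hN
  coassoc := by
    ext1 h
    refine ((isForm_fixedRing hN).tensorForm
      ((isForm_fixedRing hN).tensorForm (isForm_fixedRing hN))).injective ?_
    simp only [LinearMap.comp_apply, LinearEquiv.coe_coe]
    rw [fixedRing_coassoc_left, fixedRing_coassoc_right, fixedRingVal₂_comul,
      Coalgebra.coassoc_apply]
  rTensor_counit_comp_comul := by
    ext1 h
    refine (TensorProduct.lid F _).injective (Subtype.val_injective ?_)
    refine (fixedRing_counit_left hN _).trans ?_
    rw [fixedRingVal₂_comul, Coalgebra.rTensor_counit_comul]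
    simp
  lTensor_counit_comp_comul := by
    ext1 h
    refine (TensorProduct.rid F _).injective (Subtype.val_injective ?_)
    refine (fixedRing_counit_right hN _).trans ?_
    rw [fixedRingVal₂_comul, Coalgebra.lTensor_counit_comul]
    simp

theorem fixedRing_comul (h : fixedRing hN) :
    fixedRingVal₂ hN (Coalgebra.comul (R := F) h) =
      Coalgebra.comul (R := L) (h : MonoidAlgebra L N) :=
  fixedRingVal₂_comul hN h

theorem fixedRing_counit (h : fixedRing hN) :
    algebraMap F L (Coalgebra.counit (R := F) h) =
      Coalgebra.counit (R := L) (h : MonoidAlgebra L N) :=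
  algebraMap_fixedRingCounit hN h

noncomputable instance fixedRing.instBialgebra : Bialgebra F (fixedRing hN) :=
  Bialgebra.mk' F (fixedRing hN)
    (by
      apply (algebraMap F L).injective
      rw [fixedRing_counit, map_one]
      exact Bialgebra.counit_one)
    (by
      intro a b
      apply (algebraMap F L).injective
      rw [fixedRing_counit, map_mul, fixedRing_counit, fixedRing_counit]
      exact Bialgebra.counit_mul _ _)
    (by
      apply fixedRingVal₂_injective hN
      rw [fixedRing_comul, Algebra.TensorProduct.one_def]
      exact Bialgebra.comul_one)
    (by
      intro a b
      apply fixedRingVal₂_injective hN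
      rw [fixedRing_comul, fixedRingVal₂_mul, fixedRing_comul, fixedRing_comul]
      exact Bialgebra.comul_mul _ _)

/-- The antipode of `L[N]^G`. -/
noncomputable def fixedRingAntipode : fixedRing hN →ₗ[F] fixedRing hN where
  toFun h := ⟨HopfAlgebra.antipode L (h : MonoidAlgebra L N), (mem_fixedRing hN _).2 fun g => by
    rw [groupAlgebraAct_antipode, (mem_fixedRing hN _).1 h.2]⟩
  map_add' x y := Subtype.ext (by simp)
  map_smul' c x := Subtype.ext (by
    simp only [Subalgebra.coe_smul, RingHom.id_apply]
    rw [← algebraMap_smul L, map_smul, algebraMap_smul])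

noncomputable instance fixedRing.instHopfAlgebra : HopfAlgebra F (fixedRing hN) where
  antipode := fixedRingAntipode hN
  mul_antipode_rTensor_comul := by
    have key : ∀ t : fixedRing hN ⊗[F] fixedRing hN,
        fixedRingVal hN (LinearMap.mul' F _ ((fixedRingAntipode hN).rTensor _ t)) =
        LinearMap.mul' L _ ((HopfAlgebra.antipode L).rTensor _ (fixedRingVal₂ hN t)) := by
      intro t
      induction t with
      | zero => simp only [map_zero]
      | add x y hx hy => simp only [map_add, hx, hy]
      | tmul a b => rfl
    ext1 h
    refine Subtype.val_injective ((key _).trans ?_)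
    rw [fixedRing_comul, HopfAlgebra.mul_antipode_rTensor_comul_apply, ← fixedRing_counit,
      ← IsScalarTower.algebraMap_apply]
    rfl
  mul_antipode_lTensor_comul := by
    have key : ∀ t : fixedRing hN ⊗[F] fixedRing hN,
        fixedRingVal hN (LinearMap.mul' F _ ((fixedRingAntipode hN).lTensor _ t)) =
        LinearMap.mul' L _ ((HopfAlgebra.antipode L).lTensor _ (fixedRingVal₂ hN t)) := by
      intro t
      induction t with
      | zero => simp only [map_zero]
      | add x y hx hy => simp only [map_add, hx, hy]
      | tmul a b => rfl
    ext1 h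
    refine Subtype.val_injective ((key _).trans ?_)
    rw [fixedRing_comul, HopfAlgebra.mul_antipode_lTensor_comul_apply, ← fixedRing_counit,
      ← IsScalarTower.algebraMap_apply]
    rfl

end FixedRingHopf

/-! ### Hopf–Galois structures and their underlying groups -/

section UnderlyingGroup

variable {F : Type u} {L : Type v} [Field F] [Field L] [Algebra F L]

open MonoidAlgebra

/-- The action of `L[N]^G` on `L`. -/
noncomputable def fixedRingAct [FiniteDimensional F L] {N : Subgroup (Equiv.Perm Gal(L/F))}
    (hN : IsNormalizedByLeftReg N) : fixedRing hN →ₐ[F] Module.End F L :=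
  AlgHom.ofLinearMap ((galAction F L N).restrictScalars F ∘ₗ fixedRingVal hN)
    (by
      ext x
      refine (galAction_single (1 : N) 1 x).trans ?_
      simp)
    (fun x y => galAction_mul hN _ _ y.2)

namespace HopfGaloisStructure

theorem HasUnderlyingGroup.of_equivalent {S T : HopfGaloisStructure F L}
    {N : Subgroup (Equiv.Perm Gal(L/F))} (hT : T.HasUnderlyingGroup N) (hST : S.Equivalent T) :
    S.HasUnderlyingGroup N := by
  obtain ⟨e, hact⟩ := hST
  obtain ⟨hreg, hN, φ, hc, he, ha⟩ := hT
  refine ⟨hreg, hN, (e : S.H ≃ₐ[F] T.H).trans φ, fun h => ?_, fun h => ?_, fun h x => ?_⟩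
  · refine (hc (e h)).trans ?_
    rw [← CoalgHomClass.map_comp_comul_apply]
    congr 1
    have key : ∀ t : S.H ⊗[F] S.H,
        TensorProduct.map ((fixedRing hN).val.comp φ.toAlgHom).toLinearMap
            ((fixedRing hN).val.comp φ.toAlgHom).toLinearMap (TensorProduct.map (e : S.H →ₗ[F] T.H)
              (e : S.H →ₗ[F] T.H) t) =
        TensorProduct.map ((fixedRing hN).val.comp
            ((e : S.H ≃ₐ[F] T.H).trans φ).toAlgHom).toLinearMap
            ((fixedRing hN).val.comp ((e : S.H ≃ₐ[F] T.H).trans φ).toAlgHom).toLinearMap t := by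
      intro t
      induction t with
      | zero => simp only [map_zero]
      | add x y hx hy => simp only [map_add, hx, hy]
      | tmul a b => rfl
    exact key _
  · refine (he (e h)).trans ?_
    rw [CoalgHomClass.counit_comp_apply]
  · rw [← hact]
    exact ha (e h) x

end HopfGaloisStructure

variable [FiniteDimensional F L] [IsGalois F L] {N : Subgroup (Equiv.Perm Gal(L/F))}

/-- Over `L` the comultiplication is `η ↦ η ⊗ η`, and each `η` acts by a field automorphism, which
is multiplicative. -/
theorem fixedRingAct_mul (hN : IsNormalizedByLeftReg N) (h : fixedRing hN) (x y : L) :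
    fixedRingAct hN h (x * y) = LinearMap.mul' F L
      (TensorProduct.map ((fixedRingAct hN).toLinearMap.flip x)
        ((fixedRingAct hN).toLinearMap.flip y) (Coalgebra.comul (R := F) h)) := by
  have := Fintype.ofFinite N
  let ev : L → MonoidAlgebra L N →ₗ[L] L := fun x =>
    { toFun := fun w => galAction F L N w x
      map_add' := fun _ _ => by simp
      map_smul' := fun _ _ => by simp }
  have key : ∀ t : fixedRing hN ⊗[F] fixedRing hN, LinearMap.mul' F L
      (TensorProduct.map ((fixedRingAct hN).toLinearMap.flip x)
        ((fixedRingAct hN).toLinearMap.flip y) t) =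
      LinearMap.mul' L L (TensorProduct.map (ev x) (ev y) (fixedRingVal₂ hN t)) := by
    intro t
    induction t with
    | zero => simp only [map_zero]
    | add x y hx hy => simp only [map_add, hx, hy]
    | tmul a b => rfl
  refine Eq.trans ?_ (key _).symm
  rw [fixedRing_comul, comul_groupAlgebra]
  simp only [map_sum, map_smul, TensorProduct.map_tmul, LinearMap.mul'_apply]
  simp only [ev, LinearMap.coe_mk, AddHom.coe_mk, galAction_single, one_mul, ← map_mul]
  exact (galAction_apply _ _).trans (Finsupp.sum_fintype _ _ (by simp))

theorem fixedRingAct_one (hN : IsNormalizedByLeftReg N) (h : fixedRing hN) :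
    fixedRingAct hN h 1 = algebraMap F L (Coalgebra.counit (R := F) h) := by
  have := Fintype.ofFinite N
  rw [fixedRing_counit, counit_groupAlgebra]
  refine (galAction_apply _ _).trans ?_
  rw [Finsupp.sum_fintype _ _ (by simp)]
  simp

/-- The map factors as `L ⊗ L[N]^G ≃ L[N] ≃ End_F(L)`. -/
theorem fixedRingAct_bijective (hreg : IsRegularSubgroup N) (hN : IsNormalizedByLeftReg N)
    (j : L ⊗[F] fixedRing hN →ₗ[F] Module.End F L)
    (hj : ∀ l h, j (l ⊗ₜ h) = l • fixedRingAct hN h) : Function.Bijective j := by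
  have h1 := (isForm_fixedRing hN).bijective_lift
    ((fixedRingVal hN).liftBaseChange L) (fun a => by simp)
  convert! (galAction_bijective (F := F) (L := L) hreg).comp h1 using 1
  funext t
  induction t with
  | zero => simp only [Function.comp_apply, map_zero]
  | add x y hx hy => simp only [Function.comp_apply, map_add] at hx hy ⊢; rw [hx, hy]
  | tmul l h =>
    rw [hj, Function.comp_apply, LinearMap.liftBaseChange_tmul, map_smul]
    rfl

namespace HopfGaloisStructure

/-- The Hopf–Galois structure given by the Hopf algebra `L[N]^G`. -/
noncomputable def ofRegular (hreg : IsRegularSubgroup N)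
    (hN : IsNormalizedByLeftReg N) : HopfGaloisStructure F L where
  H := fixedRing hN
  finite := by
    obtain ⟨n, a, -⟩ := isForm_fixedRing hN
    exact .of_basis a
  act := fixedRingAct hN
  act_mul := fixedRingAct_mul hN
  act_one := fixedRingAct_one hN
  bijective := fixedRingAct_bijective hreg hN _ fun _ _ => rfl

theorem ofRegular_hasUnderlyingGroup (hreg : IsRegularSubgroup N)
    (hN : IsNormalizedByLeftReg N) : (ofRegular hreg hN).HasUnderlyingGroup N :=
  ⟨hreg, hN, AlgEquiv.refl, fun h => (fixedRing_comul hN h).symm,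
    fun h => (fixedRing_counit hN h).symm, fun _ _ => galAction_apply _ _⟩

/-- Match elements of `N` and `N'` that act on `L` by the same automorphism. The induced map of
group algebras identifies the two images of `S.H`, so it respects products and the Galois action;
equivariance then forces matched permutations to agree at every point, not only at `1`. -/
theorem HasUnderlyingGroup.le {S : HopfGaloisStructure F L}
    {N N' : Subgroup (Equiv.Perm Gal(L/F))} (h : S.HasUnderlyingGroup N)
    (h' : S.HasUnderlyingGroup N') : N ≤ N' := by
  obtain ⟨hreg, hN, φ, -, -, hact⟩ := h
  obtain ⟨hreg', hN', φ', -, -, hact'⟩ := h'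
  have hb : ∀ η : N, ∃ θ : N', (θ : Equiv.Perm Gal(L/F))⁻¹ 1 = (η : Equiv.Perm Gal(L/F))⁻¹ 1 := by
    intro η
    obtain ⟨θ, hθ, h⟩ := hreg'.transitive ((η : Equiv.Perm Gal(L/F))⁻¹ 1) 1
    exact ⟨⟨θ, hθ⟩, by rw [Equiv.Perm.inv_eq_iff_eq, h]⟩
  choose b hb using hb
  let B : MonoidAlgebra L N →ₗ[L] MonoidAlgebra L N' :=
    (groupAlgebraBasis L N).constr L fun η => single (b η) (1 : L)
  have hBs : ∀ η, B (single η 1) = single (b η) 1 := fun η =>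
    (groupAlgebraBasis L N).constr_basis L _ η
  have hBact : ∀ x, galAction F L N' (B x) = galAction F L N x := by
    intro x
    refine LinearMap.congr_fun (f := galAction F L N' ∘ₗ B) ((groupAlgebraBasis L N).ext ?_) x
    intro η
    ext y
    refine (LinearMap.congr_fun (congrArg (galAction F L N') (hBs η)) y).trans ?_
    refine Eq.trans ?_ (galAction_single η 1 y).symm
    rw [galAction_single, hb]
  -- Both sides act on `L` as `s` does, and the action of `L[N']` is faithful.
  have hB : ∀ s : S.H, B (φ s) = φ' s := by
    intro s
    refine galAction_injective (F := F) hreg' ?_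
    rw [hBact]
    ext y
    rw [galAction_apply, ← hact, galAction_apply, ← hact']
  have hB' : ∀ x ∈ fixedRing hN, ∃ s : S.H, (φ s : MonoidAlgebra L N) = x := fun x hx =>
    ⟨φ.symm ⟨x, hx⟩, by simp⟩
  -- Multiplicativity of `B` holds on the fixed ring, hence on its `L`-span, which is all of `L[N]`.
  have hmul : ∀ η θ, b (η * θ) = b η * b θ := by
    have h1 : (LinearMap.mul L (MonoidAlgebra L N)).compr₂ B =
        (LinearMap.mul L (MonoidAlgebra L N')).compl₁₂ B B := by
      refine LinearMap.ext_on (span_fixedRing hN) fun x hx => ?_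
      refine LinearMap.ext_on (span_fixedRing hN) fun y hy => ?_
      obtain ⟨s, rfl⟩ := hB' x hx
      obtain ⟨t, rfl⟩ := hB' y hy
      simp only [LinearMap.compr₂_apply, LinearMap.mul_apply', LinearMap.compl₁₂_apply, hB]
      rw [← Subalgebra.coe_mul, ← map_mul, hB, map_mul, Subalgebra.coe_mul]
    intro η θ
    have h2 := LinearMap.congr_fun₂ h1 (single η 1) (single θ 1)
    simp only [LinearMap.compr₂_apply, LinearMap.mul_apply', LinearMap.compl₁₂_apply, hBs,
      single_mul_single, mul_one] at h2
    exact single_left_injective one_ne_zero h2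
  have hconj : ∀ (g : Gal(L/F)) η, b (twistedConj hN g η) = twistedConj hN' g (b η) := by
    intro g η
    have h1 : ∀ x, B (groupAlgebraAct hN g x) = groupAlgebraAct hN' g (B x) := by
      intro x
      have hx : x ∈ Submodule.span L (fixedRing hN : Set (MonoidAlgebra L N)) := by
        rw [span_fixedRing]; trivial
      induction hx using Submodule.span_induction with
      | mem x hx =>
        obtain ⟨s, rfl⟩ := hB' x hx
        rw [(mem_fixedRing hN _).1 hx, hB, (mem_fixedRing hN' _).1 (φ' s).2]
      | zero => simp
      | add x y _ _ hx hy => simp [hx, hy]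
      | smul l x _ hx => simp [groupAlgebraAct_smul, hx]
    have h2 := h1 (single η 1)
    rw [hBs, groupAlgebraAct_single, groupAlgebraAct_single, map_one, hBs] at h2
    exact single_left_injective one_ne_zero h2
  have hone : b 1 = 1 := by simpa using hmul 1 1
  have hinv : ∀ η, b η⁻¹ = (b η)⁻¹ := fun η =>
    eq_inv_of_mul_eq_one_left (by rw [← hmul, inv_mul_cancel, hone])
  have heval : ∀ η, (b η : Equiv.Perm Gal(L/F)) 1 = (η : Equiv.Perm Gal(L/F)) 1 := by
    intro η
    simpa [hinv] using hb η⁻¹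
  have heq : ∀ η, (b η : Equiv.Perm Gal(L/F)) = η := by
    intro η
    ext1 g
    -- Conjugation by `λ(g⁻¹)` moves the evaluation point from `1` to `g`.
    have := heval (twistedConj hN g⁻¹ η)
    rw [hconj] at this
    simpa [twistedConj_coe, leftReg] using this
  intro η hη
  have h := (b ⟨η, hη⟩).2
  rwa [heq] at h

theorem HasUnderlyingGroup.unique {S : HopfGaloisStructure F L} {N N' : Subgroup (Equiv.Perm Gal(L/F))}
    (h : S.HasUnderlyingGroup N) (h' : S.HasUnderlyingGroup N') : N = N' :=
  le_antisymm (h.le h') (h'.le h)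

/-- Both Hopf algebras are identified with the same `L[N]^G`; compatibility with the coalgebra
structures is tested in `L[N]` and `L[N] ⊗ L[N]`. -/
theorem HasUnderlyingGroup.equivalent {S T : HopfGaloisStructure F L} {N : Subgroup (Equiv.Perm Gal(L/F))}
    (hS : S.HasUnderlyingGroup N) (hT : T.HasUnderlyingGroup N) : S.Equivalent T := by
  obtain ⟨-, hN, φ, hc, he, ha⟩ := hS
  obtain ⟨-, _, φ', hc', he', ha'⟩ := hT
  let e : S.H ≃ₐ[F] T.H := φ.trans φ'.symm
  have hφ : ∀ h, φ' (e h) = φ h := fun h => by simp [e]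
  have hcounit : ∀ h, Coalgebra.counit (R := F) (e h) = Coalgebra.counit (R := F) h := by
    intro h
    apply (algebraMap F L).injective
    rw [← he, ← he', hφ]
  have hcomul : ∀ h, TensorProduct.map e.toLinearMap e.toLinearMap (Coalgebra.comul (R := F) h) =
      Coalgebra.comul (R := F) (e h) := by
    intro h
    have hinj : Function.Injective (TensorProduct.map φ'.toLinearMap φ'.toLinearMap) :=
      (TensorProduct.congr φ'.toLinearEquiv φ'.toLinearEquiv).injective
    refine hinj (fixedRingVal₂_injective hN ?_)
    have key : ∀ t : T.H ⊗[F] T.H,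
        fixedRingVal₂ hN (TensorProduct.map φ'.toLinearMap φ'.toLinearMap t) =
        TensorProduct.mapOfCompatibleSMul L F L (MonoidAlgebra L N) (MonoidAlgebra L N)
          (TensorProduct.map ((fixedRing hN).val.comp φ'.toAlgHom).toLinearMap
            ((fixedRing hN).val.comp φ'.toAlgHom).toLinearMap t) := by
      intro t
      induction t with
      | zero => simp only [map_zero]
      | add x y hx hy => simp only [map_add, hx, hy]
      | tmul a b => rfl
    have key' : ∀ t : S.H ⊗[F] S.H,
        fixedRingVal₂ hN (TensorProduct.map φ'.toLinearMap φ'.toLinearMap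
          (TensorProduct.map e.toLinearMap e.toLinearMap t)) =
        TensorProduct.mapOfCompatibleSMul L F L (MonoidAlgebra L N) (MonoidAlgebra L N)
          (TensorProduct.map ((fixedRing hN).val.comp φ.toAlgHom).toLinearMap
            ((fixedRing hN).val.comp φ.toAlgHom).toLinearMap t) := by
      intro t
      induction t with
      | zero => simp only [map_zero]
      | add x y hx hy => simp only [map_add, hx, hy]
      | tmul a b => simp [hφ]
    refine (key' _).trans ((hc h).symm.trans (Eq.trans ?_ (key _).symm))
    rw [← hφ]
    exact hc' _
  refine ⟨BialgEquiv.ofAlgEquiv e (AlgHom.ext hcounit) (AlgHom.ext hcomul), fun h => ?_⟩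
  ext x
  refine (ha' (e h) x).trans ?_
  rw [hφ, ha]

end HopfGaloisStructure

end UnderlyingGroup

/-! ### Computation in the quaternion group -/

section Quaternion

variable {G : Type*} [Group G]

/-- `s` and `t` generate a quaternion group of order `8` with central involution `z`. -/
structure IsQuaternionPair (s t z : G) : Prop where
  s_mul_s : s * s = z
  t_mul_t : t * t = z
  z_mul_z : z * z = 1
  s_mul_z : s * z = z * s
  t_mul_z : t * z = z * t
  t_mul_s : t * s = z * (s * t)
  z_ne_one : z ≠ 1
  exhaust : ∀ x, x = 1 ∨ x = z ∨ x = s ∨ x = z * s ∨ x = t ∨ x = z * t ∨ x = s * t ∨ x = z * (s * t)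
  card_eq : Nat.card G = 8

theorem QuaternionGroup.exhaust_of_not_commute : ∀ s t : QuaternionGroup 2, s * t ≠ t * s →
    ∀ x, x = 1 ∨ x = s ^ 2 ∨ x = s ∨ x = s ^ 2 * s ∨ x = t ∨ x = s ^ 2 * t ∨ x = s * t ∨
      x = s ^ 2 * (s * t) := by
  decide

theorem isQuaternionPair_of_closure_eq_top (hG : Nonempty (G ≃* QuaternionGroup 2)) {s t : G}
    (hgen : Subgroup.closure {s, t} = ⊤) (hs : s ^ 4 = 1) (hst : s ^ 2 = t ^ 2)
    (hrel : s * t = t * s⁻¹) : IsQuaternionPair s t (s ^ 2) := by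
  obtain ⟨e⟩ := hG
  have hnc : s * t ≠ t * s := by
    intro h
    -- Commuting generators would make `G` abelian: first everything centralises `s` and `t`, then
    -- these, being central, generate a central subgroup.
    have h1 : Subgroup.closure {s, t} ≤ Subgroup.centralizer {s, t} := by
      rw [Subgroup.closure_le]
      rintro x (rfl | rfl) y (rfl | rfl) <;> first | rfl | exact h | exact h.symm
    rw [hgen] at h1
    have h2 : Subgroup.closure {s, t} ≤ Subgroup.center G := by
      rw [Subgroup.closure_le]
      rintro x hx
      refine Subgroup.mem_center_iff.2 fun g => ?_
      exact ((h1 (Subgroup.mem_top g)) x hx).symm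
    rw [hgen] at h2
    have h3 := Subgroup.mem_center_iff.1 (h2 (Subgroup.mem_top (e.symm (.a 1)))) (e.symm (.xa 0))
    rw [← map_mul, ← map_mul] at h3
    exact absurd (e.symm.injective h3) (by decide)
  have hts : t * s = s ^ 2 * (s * t) := by
    have h1 : t = s * t * s := by rw [hrel, inv_mul_cancel_right]
    have h2 : s ^ 2 * (s * t) = s⁻¹ * s ^ 4 * t := by group
    rw [h2, hs, mul_one]
    conv_rhs => rw [h1]
    group
  refine ⟨(pow_two s).symm, hst ▸ (pow_two t).symm, by rw [← pow_add, hs], ?_, ?_, hts, ?_, ?_, ?_⟩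
  · rw [← pow_succ, ← pow_succ']
  · rw [hst, ← pow_succ, ← pow_succ']
  · intro h
    rw [h, one_mul] at hts
    exact hnc hts.symm
  · intro x
    have := QuaternionGroup.exhaust_of_not_commute (e s) (e t) (by
      rw [← map_mul, ← map_mul]
      exact fun h => hnc (e.injective h)) (e x)
    simpa only [← map_mul, ← map_pow, e.injective.eq_iff, ← map_one e] using this
  · rw [Nat.card_congr e.toEquiv, Nat.card_eq_fintype_card]
    decide

namespace IsQuaternionPair

variable {s t z : G} (h : IsQuaternionPair s t z)

include h

theorem s_mul_t : s * t = z * (t * s) := by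
  rw [h.t_mul_s, ← mul_assoc z z, h.z_mul_z, one_mul]

/-- This symmetry yields every statement about `E_{t,s}` from the one about `E_{s,t}`. -/
theorem symm : IsQuaternionPair t s z where
  s_mul_s := h.t_mul_t
  t_mul_t := h.s_mul_s
  z_mul_z := h.z_mul_z
  s_mul_z := h.t_mul_z
  t_mul_z := h.s_mul_z
  t_mul_s := h.s_mul_t
  z_ne_one := h.z_ne_one
  exhaust x := by
    rw [h.t_mul_s, ← mul_assoc z z, h.z_mul_z, one_mul]
    have := h.exhaust x
    tauto
  card_eq := h.card_eq

theorem s_inv : s⁻¹ = z * s := inv_eq_of_mul_eq_one_left (by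
  rw [mul_assoc, h.s_mul_s, h.z_mul_z])

theorem t_inv : t⁻¹ = z * t := h.symm.s_inv

/-- The variants with a trailing factor let `simp` reduce right-associated words, moving `z` to the
left and `s` before `t`. -/
theorem z_mul_z_mul (x : G) : z * (z * x) = x := by rw [← mul_assoc, h.z_mul_z, one_mul]

theorem s_mul_s_mul (x : G) : s * (s * x) = z * x := by rw [← mul_assoc, h.s_mul_s]

theorem t_mul_t_mul (x : G) : t * (t * x) = z * x := by rw [← mul_assoc, h.t_mul_t]

theorem s_mul_z_mul (x : G) : s * (z * x) = z * (s * x) := by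
  rw [← mul_assoc, h.s_mul_z, mul_assoc]

theorem t_mul_z_mul (x : G) : t * (z * x) = z * (t * x) := by
  rw [← mul_assoc, h.t_mul_z, mul_assoc]

theorem t_mul_s_mul (x : G) : t * (s * x) = z * (s * (t * x)) := by
  rw [← mul_assoc, h.t_mul_s, mul_assoc, mul_assoc]

theorem not_commute : t * s ≠ s * t := by
  rw [h.t_mul_s]
  exact fun h' => h.z_ne_one (mul_eq_right.1 h')

theorem z_mul_comm (x : G) : x * z = z * x := by
  rcases h.exhaust x with rfl | rfl | rfl | rfl | rfl | rfl | rfl | rfl <;>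
    simp only [mul_one, one_mul, mul_assoc, h.s_mul_z, h.t_mul_z, h.s_mul_z_mul]

theorem eq_z_of_mul_self {x : G} (hx : x * x = 1) (hx1 : x ≠ 1) : x = z := by
  have hz := h.z_ne_one
  rcases h.exhaust x with rfl | rfl | rfl | rfl | rfl | rfl | rfl | rfl <;>
    simp only [mul_assoc, h.s_mul_s, h.t_mul_t, h.s_mul_z, h.s_mul_z_mul, h.t_mul_z_mul,
      h.t_mul_s_mul, h.z_mul_z, mul_one, h.z_mul_z_mul] at hx hx1 ⊢ <;>
    first | exact absurd hx hz | exact absurd rfl hx1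

end IsQuaternionPair

end Quaternion

/-! ### Elementary abelian groups of order eight and regularity -/

section ElementaryAbelian

variable {P : Type*} [Group P]

/-- The homomorphism `C₂ → P` given by an element of order dividing `2`. -/
def involutionHom (a : P) (ha : a * a = 1) : Multiplicative (ZMod 2) →* P where
  toFun i := if i = 1 then 1 else a
  map_one' := by simp
  map_mul' i j := by
    have key : ∀ i j : Multiplicative (ZMod 2), (i = 1 ∧ i * j = j) ∨ (j = 1 ∧ i * j = i) ∨
        (i ≠ 1 ∧ j ≠ 1 ∧ i * j = 1) := by decide
    rcases key i j with ⟨h1, h2⟩ | ⟨h1, h2⟩ | ⟨h1, h2, h3⟩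
    · simp [h1]
    · simp [h1]
    · simp [h1, h2, h3, ha]

theorem involutionHom_apply (a : P) (ha : a * a = 1) (i : Multiplicative (ZMod 2)) :
    involutionHom a ha i = 1 ∨ involutionHom a ha i = a := by
  unfold involutionHom
  by_cases hi : i = 1
  · exact .inl (if_pos hi)
  · exact .inr (if_neg hi)

/-- The homomorphism `C₂³ → P` given by three commuting elements of order dividing `2`. -/
def involutionHom₃ (a b c : P) (ha : a * a = 1) (hb : b * b = 1) (hc : c * c = 1)
    (hab : a * b = b * a) (hac : a * c = c * a) (hbc : b * c = c * b) : C2Cubed →* P :=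
  (involutionHom a ha).noncommCoprod
    ((involutionHom b hb).noncommCoprod (involutionHom c hc) (fun i j => by
      rcases involutionHom_apply b hb i with h | h <;>
        rcases involutionHom_apply c hc j with h' | h' <;> simp [h, h', Commute, SemiconjBy, hbc]))
    (fun i j => by
      have hb' : Commute a b := hab
      have hc' : Commute a c := hac
      rw [MonoidHom.noncommCoprod_apply]
      rcases involutionHom_apply a ha i with h | h <;>
        rcases involutionHom_apply b hb j.1 with h' | h' <;>
        rcases involutionHom_apply c hc j.2 with h'' | h'' <;>
        simp [h, h', h'', hb', hc'])

theorem involutionHom₃_apply (a b c : P) (ha : a * a = 1) (hb : b * b = 1) (hc : c * c = 1)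
    (hab : a * b = b * a) (hac : a * c = c * a) (hbc : b * c = c * b) (v : C2Cubed) :
    involutionHom₃ a b c ha hb hc hab hac hbc v =
      (if v.1 = 1 then 1 else a) * ((if v.2.1 = 1 then 1 else b) * (if v.2.2 = 1 then 1 else c)) :=
  rfl

theorem range_involutionHom₃ (a b c : P) (ha : a * a = 1) (hb : b * b = 1) (hc : c * c = 1)
    (hab : a * b = b * a) (hac : a * c = c * a) (hbc : b * c = c * b) :
    (involutionHom₃ a b c ha hb hc hab hac hbc).range = Subgroup.closure {a, b, c} := by
  have hne : (Multiplicative.ofAdd (1 : ZMod 2)) ≠ 1 := by decide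
  apply le_antisymm
  · rintro _ ⟨v, rfl⟩
    rw [involutionHom₃_apply]
    have mem : ∀ (p : Prop) [Decidable p] (x : P), x ∈ ({a, b, c} : Set P) →
        (if p then 1 else x) ∈ Subgroup.closure {a, b, c} := by
      intro p _ x hx
      split_ifs
      · exact one_mem _
      · exact Subgroup.subset_closure hx
    exact mul_mem (mem _ _ (by simp)) (mul_mem (mem _ _ (by simp)) (mem _ _ (by simp)))
  · rw [Subgroup.closure_le]
    rintro x (rfl | rfl | rfl)
    · exact ⟨(.ofAdd 1, 1, 1), by simp [involutionHom₃_apply, hne]⟩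
    · exact ⟨(1, .ofAdd 1, 1), by simp [involutionHom₃_apply, hne]⟩
    · exact ⟨(1, 1, .ofAdd 1), by simp [involutionHom₃_apply, hne]⟩

theorem card_C2Cubed : Nat.card C2Cubed = 8 := by
  simp [C2Cubed]

theorem C2Cubed.mul_self : ∀ v : C2Cubed, v * v = 1 := by decide

variable {G : Type*} [Group G]

/-- A homomorphism from `C₂³` to the permutations of a group of order `8` whose image acts
transitively is an isomorphism onto a regular subgroup. -/
theorem isRegularSubgroup_range (hG : Nat.card G = 8) (f : C2Cubed →* Equiv.Perm G)
    (hf : ∀ x, ∃ v, f v 1 = x) : IsRegularSubgroup f.range ∧ Nat.card f.range = 8 ∧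
      Nonempty (f.range ≃* C2Cubed) := by
  have : Finite G := Nat.finite_of_card_ne_zero (by rw [hG]; norm_num)
  -- A surjection between sets of size `8`; its injectivity gives both faithfulness and trivial
  -- stabilisers.
  have hbij : Function.Bijective fun v => f v 1 :=
    (Nat.bijective_iff_surjective_and_card _).2 ⟨hf, by rw [card_C2Cubed, hG]⟩
  have hinj : Function.Injective f := fun v w h => hbij.1 (by simp only [h])
  have e := (f.ofInjective hinj).symm
  have hcard : Nat.card f.range = 8 := by rw [Nat.card_congr e.toEquiv, card_C2Cubed]
  refine ⟨⟨by rw [hcard, hG], ?_, ?_⟩, hcard, ⟨e⟩⟩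
  · rintro g _ ⟨v, rfl⟩ hv
    obtain ⟨w, rfl⟩ := hf g
    rw [← Equiv.Perm.mul_apply, ← map_mul] at hv
    have := hbij.1 hv
    rw [mul_eq_right.1 this, map_one]
  · intro g k
    obtain ⟨v, rfl⟩ := hf g
    obtain ⟨w, rfl⟩ := hf k
    refine ⟨f (w * v⁻¹), ⟨_, rfl⟩, ?_⟩
    rw [← Equiv.Perm.mul_apply, ← map_mul, inv_mul_cancel_right]

end ElementaryAbelian

/-! ### The groups `E_{s,t}` -/

section GroupE

variable {G : Type*} [Group G]

theorem leftReg_apply (g x : G) : leftReg g x = g * x := rfl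

theorem rightReg_apply (g x : G) : rightReg g x = x * g⁻¹ := rfl

theorem leftReg_mul_rightReg (g h : G) : leftReg g * rightReg h = rightReg h * leftReg g := by
  ext x
  simp [leftReg_apply, rightReg_apply, mul_assoc]

theorem leftReg_conj (g x y : G) :
    leftReg g * (leftReg x * rightReg y) * (leftReg g)⁻¹ =
      leftReg (g * x * g⁻¹) * rightReg y := by
  rw [mul_assoc, mul_assoc (leftReg x), ← map_inv, ← leftReg_mul_rightReg, map_mul, map_mul]
  simp only [mul_assoc]

/-- Conjugates of `λ(x)ρ(y)` by `λ(g)`, when `x` has at most two conjugates `x` and `zx`. -/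
theorem leftReg_conj_mem {x z : G} (hx : ∀ g, g * x = x * g ∨ g * x = z * (x * g)) {y : G}
    {N : Subgroup (Equiv.Perm G)} (hz : leftReg z ∈ N) (hxy : leftReg x * rightReg y ∈ N) (g : G) :
    leftReg g * (leftReg x * rightReg y) * (leftReg g)⁻¹ ∈ N := by
  rw [leftReg_conj]
  rcases hx g with h1 | h1
  · rwa [h1, mul_inv_cancel_right]
  · rw [h1, ← mul_assoc, mul_inv_cancel_right, map_mul, mul_assoc]
    exact mul_mem hz hxy

namespace IsQuaternionPair

variable {s t z : G} (h : IsQuaternionPair s t z)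

include h

theorem groupE_eq : groupE s t =
    Subgroup.closure {leftReg s * rightReg t, leftReg z, leftReg t * rightReg (s * t)} := by
  rw [groupE, pow_two, h.s_mul_s]

theorem mul_s (g : G) : g * s = s * g ∨ g * s = z * (s * g) := by
  rcases h.exhaust g with rfl | rfl | rfl | rfl | rfl | rfl | rfl | rfl <;>
    simp [mul_assoc, h.s_mul_s, h.s_mul_z, h.s_mul_z_mul, h.s_mul_s_mul, h.t_mul_s]

/-- Conjugation by `λ(g)` changes each generator at most by the factor `λ(z)`, which belongs to the
group. -/
theorem isNormalizedByLeftReg_groupE : IsNormalizedByLeftReg (groupE s t) := by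
  rw [h.groupE_eq]
  intro g
  set N := Subgroup.closure
    {leftReg s * rightReg t, leftReg z, leftReg t * rightReg (s * t)} with hN
  have hsub : N ≤ N.comap (MulAut.conj (leftReg g)).toMonoidHom := by
    rw [hN, Subgroup.closure_le, ← hN]
    have hz : leftReg z ∈ N := Subgroup.subset_closure (by simp)
    have key : ∀ x ∈ ({leftReg s * rightReg t, leftReg z, leftReg t * rightReg (s * t)} :
        Set (Equiv.Perm G)), leftReg g * x * (leftReg g)⁻¹ ∈ N := by
      rintro x (rfl | rfl | rfl)
      · exact leftReg_conj_mem h.mul_s hz (Subgroup.subset_closure (by simp)) g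
      · rw [← map_inv, ← map_mul, ← map_mul, h.z_mul_comm, mul_inv_cancel_right]
        exact hz
      · exact leftReg_conj_mem h.symm.mul_s hz (Subgroup.subset_closure (by simp)) g
    exact key
  exact fun η hη => hsub hη

theorem groupE_regular : IsRegularSubgroup (groupE s t) ∧ Nat.card (groupE s t) = 8 ∧
    Nonempty (groupE s t ≃* C2Cubed) := by
  have ha : (leftReg s * rightReg t) * (leftReg s * rightReg t) = 1 := by
    ext x
    simp [leftReg_apply, rightReg_apply, h.t_inv, mul_assoc, h.z_mul_comm, h.t_mul_t,
      h.s_mul_s_mul, h.z_mul_z_mul, h.z_mul_z, h.t_mul_z_mul]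
  have hb : leftReg z * leftReg z = 1 := by
    rw [← map_mul, h.z_mul_z, map_one]
  have hc : (leftReg t * rightReg (s * t)) * (leftReg t * rightReg (s * t)) = 1 := by
    ext x
    simp [leftReg_apply, rightReg_apply, h.t_inv, h.s_inv, mul_assoc, h.z_mul_comm, h.t_mul_t,
      h.s_mul_s, h.z_mul_z_mul, h.z_mul_z, h.t_mul_z_mul, h.s_mul_z_mul, h.t_mul_s_mul,
      h.t_mul_t_mul]
  have hab : (leftReg s * rightReg t) * leftReg z = leftReg z * (leftReg s * rightReg t) := by
    ext x
    simp [leftReg_apply, rightReg_apply, h.s_mul_z_mul, mul_assoc]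
  have hbc : leftReg z * (leftReg t * rightReg (s * t)) =
      (leftReg t * rightReg (s * t)) * leftReg z := by
    ext x
    simp [leftReg_apply, rightReg_apply, h.t_mul_z_mul, mul_assoc]
  have hac : (leftReg s * rightReg t) * (leftReg t * rightReg (s * t)) =
      (leftReg t * rightReg (s * t)) * (leftReg s * rightReg t) := by
    ext x
    have hx' : ∀ y, x * (z * y) = z * (x * y) := fun y => by
      rw [← mul_assoc, h.z_mul_comm, mul_assoc]
    simp [leftReg_apply, rightReg_apply, h.t_inv, h.s_inv, mul_assoc, h.t_mul_t, hx',
      h.z_mul_z_mul, h.z_mul_z, h.t_mul_z_mul, h.s_mul_z_mul, h.t_mul_s_mul, h.t_mul_s]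
  rw [h.groupE_eq, ← range_involutionHom₃ _ _ _ ha hb hc hab hac hbc]
  refine isRegularSubgroup_range h.card_eq _ fun x => ?_
  have hne : (Multiplicative.ofAdd (1 : ZMod 2)) ≠ 1 := by decide
  -- The three generators send `1` to `z st`, `z` and `zs`; the witnesses record which generators to
  -- multiply.
  rcases h.exhaust x with rfl | rfl | rfl | rfl | rfl | rfl | rfl | rfl
  · exact ⟨(1, 1, 1), by rw [involutionHom₃_apply]; simp⟩
  · exact ⟨(1, .ofAdd 1, 1), by rw [involutionHom₃_apply]; simp [hne, leftReg_apply]⟩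
  · exact ⟨(1, .ofAdd 1, .ofAdd 1), by
      rw [involutionHom₃_apply]
      simp [hne, leftReg_apply, rightReg_apply, h.s_inv, h.z_mul_z_mul]⟩
  · exact ⟨(1, 1, .ofAdd 1), by
      rw [involutionHom₃_apply]
      simp [hne, leftReg_apply, rightReg_apply, h.s_inv]⟩
  · exact ⟨(.ofAdd 1, .ofAdd 1, .ofAdd 1), by
      rw [involutionHom₃_apply]
      simp [hne, leftReg_apply, rightReg_apply, h.s_inv, h.t_inv, h.s_mul_z_mul, h.s_mul_s_mul,
        h.t_mul_z_mul, h.t_mul_s_mul, h.t_mul_t, h.z_mul_z_mul, h.s_mul_z, h.t_mul_s, mul_assoc]⟩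
  · exact ⟨(.ofAdd 1, 1, .ofAdd 1), by
      rw [involutionHom₃_apply]
      simp [hne, leftReg_apply, rightReg_apply, h.s_inv, h.t_inv, h.s_mul_z_mul, h.s_mul_s_mul,
        h.t_mul_z_mul, h.t_mul_s_mul, h.t_mul_t, h.z_mul_z_mul, h.s_mul_z, h.t_mul_s, mul_assoc]⟩
  · exact ⟨(.ofAdd 1, .ofAdd 1, 1), by
      rw [involutionHom₃_apply]
      simp [hne, leftReg_apply, rightReg_apply, h.t_inv, h.z_mul_z_mul, mul_assoc]⟩
  · exact ⟨(.ofAdd 1, 1, 1), by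
      rw [involutionHom₃_apply]
      simp [hne, leftReg_apply, rightReg_apply, h.t_inv, h.s_mul_z_mul]⟩

end IsQuaternionPair

end GroupE

/-! ### Classification of the regular subgroups of exponent two -/

section Classification

variable {G : Type*}

/-- An element of a regular subgroup is determined by its value at a point. -/
theorem IsRegularSubgroup.ext {N : Subgroup (Equiv.Perm G)} (hN : IsRegularSubgroup N)
    {η θ : Equiv.Perm G} (hη : η ∈ N) (hθ : θ ∈ N) (g : G) (h : η g = θ g) : η = θ := by
  have := hN.stabilizer_trivial g (θ⁻¹ * η) (mul_mem (inv_mem hθ) hη) (by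
    rw [Equiv.Perm.mul_apply, h, ← Equiv.Perm.mul_apply, inv_mul_cancel, Equiv.Perm.one_apply])
  exact (inv_mul_eq_one.1 this).symm

variable [Group G]

namespace IsQuaternionPair

variable {s t z : G} (h : IsQuaternionPair s t z)

include h

theorem groupE_ne : groupE s t ≠ groupE t s := by
  intro heq
  have h1 : leftReg z * (leftReg s * rightReg t) ∈ groupE s t := by
    rw [h.groupE_eq]
    exact mul_mem (Subgroup.subset_closure (by simp)) (Subgroup.subset_closure (by simp))
  have h2 : leftReg t * rightReg s ∈ groupE s t := by
    rw [heq]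
    exact Subgroup.subset_closure (by simp)
  -- Both permutations send `1` to `st`, so regularity would make them equal; but they send `s` to
  -- `zt` and to `t`.
  have h3 := h.groupE_regular.1.ext h1 h2 1 (by
    simp [leftReg_apply, rightReg_apply, h.s_inv, h.t_inv, h.s_mul_z_mul, h.t_mul_z_mul, h.t_mul_s])
  have h4 := Equiv.congr_fun h3 s
  simp [leftReg_apply, rightReg_apply, h.t_inv, h.s_mul_s_mul, h.s_mul_z_mul, h.z_mul_z_mul] at h4
  exact h.z_ne_one h4

/-- A regular subgroup of exponent two normalised by `λ(G)` contains `λ(z)`. -/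
theorem leftReg_z_mem {N : Subgroup (Equiv.Perm G)} (hreg : IsRegularSubgroup N)
    (hN : IsNormalizedByLeftReg N) (hsq : ∀ η ∈ N, η * η = 1) : leftReg z ∈ N := by
  have hfin : Finite G := Nat.finite_of_card_ne_zero (by rw [h.card_eq]; norm_num)
  let _ : MulAction G N :=
    { smul := fun g η => twistedConj hN g η
      one_smul := twistedConj_one hN
      mul_smul := twistedConj_mul hN }
  have hp : IsPGroup 2 G := IsPGroup.of_card (n := 3) (by rw [h.card_eq]; norm_num)
  obtain ⟨η, hη, hne⟩ := hp.exists_fixed_point_of_prime_dvd_card_of_fixed_point N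
    (by rw [hreg.card_eq, h.card_eq]; norm_num) (a := (1 : N)) fun g => map_one (twistedConj hN g)
  -- A fixed point commutes with `λ(G)`, hence is a right multiplication.
  have hη' : ∀ g, (η : Equiv.Perm G) g = g * (η : Equiv.Perm G) 1 := by
    intro g
    have h1 : leftReg g * (η : Equiv.Perm G) * (leftReg g)⁻¹ = η := congrArg Subtype.val (hη g)
    have h2 := Equiv.congr_fun (mul_inv_eq_iff_eq_mul.1 h1) 1
    simpa [leftReg_apply] using h2.symm
  have h1 : (η : Equiv.Perm G) 1 ≠ 1 := fun h1 =>
    hne (Subtype.ext (hreg.stabilizer_trivial 1 η η.2 h1).symm)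
  have h2 := Equiv.congr_fun (hsq η η.2) 1
  rw [Equiv.Perm.mul_apply, hη', Equiv.Perm.one_apply] at h2
  have h3 := h.eq_z_of_mul_self h2 h1
  have h4 : leftReg z = (η : Equiv.Perm G) := by
    ext g
    rw [hη', h3, h.z_mul_comm, leftReg_apply]
  rw [h4]
  exact η.2

/-- Commutation with each other and with `λ(z)`, together with the given values, determines `n` and
`m` on all eight points. Then `λ(s)ρ(t) = nm` and `λ(t)ρ(st) = λ(z)n`. -/
theorem groupE_le {N : Subgroup (Equiv.Perm G)} (hz : leftReg z ∈ N) (hsq : ∀ η ∈ N, η * η = 1)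
    (hcomm : ∀ η ∈ N, ∀ θ ∈ N, η * θ = θ * η) {n m : Equiv.Perm G} (hn : n ∈ N) (hm : m ∈ N)
    (hn1 : n 1 = s) (hm1 : m 1 = t) (hnt : n t = z * (s * t)) : groupE s t ≤ N := by
  have hnn : ∀ x, n (n x) = x := Equiv.congr_fun (hsq n hn)
  have hmm : ∀ x, m (m x) = x := Equiv.congr_fun (hsq m hm)
  have hnz : ∀ x, n (z * x) = z * n x := Equiv.congr_fun (hcomm n hn _ hz)
  have hmz : ∀ x, m (z * x) = z * m x := Equiv.congr_fun (hcomm m hm _ hz)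
  have hns : n s = 1 := by rw [← hn1, hnn]
  have hmt : m t = 1 := by rw [← hm1, hmm]
  have hnst : n (s * t) = z * t := by
    rw [← h.z_mul_z_mul (s * t), hnz, ← hnt, hnn]
  have hms : m s = z * (s * t) := by
    rw [← hnt, ← hn1, ← hm1]
    exact Equiv.congr_fun (hcomm m hm n hn) 1
  have hmst : m (s * t) = z * s := by
    rw [← h.z_mul_z_mul (s * t), hmz, ← hms, hmm]
  have hnz1 : n z = z * s := by simpa [hn1] using hnz 1
  have hmz1 : m z = z * t := by simpa [hm1] using hmz 1
  have h1 : leftReg s * rightReg t = n * m := by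
    ext x
    rcases h.exhaust x with rfl | rfl | rfl | rfl | rfl | rfl | rfl | rfl <;>
      simp [leftReg_apply, rightReg_apply, hn1, hm1, hnz, hmz, hns, hmt, hnt, hnst, hms, hmst,
        hnz1, hmz1, h.t_inv, mul_assoc, h.s_mul_z_mul, h.t_mul_z_mul, h.s_mul_s_mul, h.s_mul_s,
        h.t_mul_t, h.s_mul_z, h.z_mul_z_mul, h.z_mul_z]
  have h2 : leftReg t * rightReg (s * t) = leftReg z * n := by
    ext x
    rcases h.exhaust x with rfl | rfl | rfl | rfl | rfl | rfl | rfl | rfl <;>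
      simp [leftReg_apply, rightReg_apply, hn1, hnz, hns, hnt, hnst, hnz1, h.t_inv, h.s_inv,
        mul_assoc, h.s_mul_z_mul, h.t_mul_z_mul, h.s_mul_s_mul, h.t_mul_s_mul, h.t_mul_t,
        h.s_mul_z, h.z_mul_z_mul, h.z_mul_z, h.t_mul_z, h.t_mul_s, h.s_mul_s]
  rw [h.groupE_eq, Subgroup.closure_le]
  rintro x (rfl | rfl | rfl)
  · rw [h1]
    exact mul_mem hn hm
  · exact hz
  · rw [h2]
    exact mul_mem hz hn

/-- The regular elementary abelian subgroups normalised by `λ(G)`. -/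
theorem eq_groupE_or {N : Subgroup (Equiv.Perm G)} (hreg : IsRegularSubgroup N)
    (hN : IsNormalizedByLeftReg N) (hsq : ∀ η ∈ N, η * η = 1) :
    N = groupE s t ∨ N = groupE t s := by
  have hfin : Finite G := Nat.finite_of_card_ne_zero (by rw [h.card_eq]; norm_num)
  have hinv : ∀ η ∈ N, η⁻¹ = η := fun η hη => inv_eq_of_mul_eq_one_left (hsq η hη)
  have hcomm : ∀ η ∈ N, ∀ θ ∈ N, η * θ = θ * η := by
    intro η hη θ hθ
    rw [← hinv _ (mul_mem hη hθ), mul_inv_rev, hinv η hη, hinv θ hθ]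
  have hz := h.leftReg_z_mem hreg hN hsq
  have heq : ∀ {a b : G} (h' : IsQuaternionPair a b z), groupE a b ≤ N → N = groupE a b := by
    intro a b h' hle
    refine (Subgroup.eq_of_le_of_card_ge hle ?_).symm
    rw [hreg.card_eq, h.card_eq, h'.groupE_regular.2.1]
  obtain ⟨n, hn, hn1⟩ := hreg.transitive 1 s
  obtain ⟨m, hm, hm1⟩ := hreg.transitive 1 t
  have hnn : ∀ x, n (n x) = x := Equiv.congr_fun (hsq n hn)
  have hnz : ∀ x, n (z * x) = z * n x := Equiv.congr_fun (hcomm n hn _ hz)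
  have hzn : n z = z * s := by simpa [hn1] using hnz 1
  have hns : n s = 1 := by rw [← hn1, hnn]
  have hcs : t * s ≠ s * t := h.not_commute
  -- Injectivity of `n` excludes the values `1, z, s, zs` of `n t`, which `n` takes at points
  -- commuting with `s`. The values `t` and `zt` would force `n = 1` or `n = λ(z)`.
  have hnot : ∀ x, n x = n t → x * s = s * x → False := by
    intro x hx hxs
    rw [n.injective hx] at hxs
    exact hcs hxs
  rcases h.exhaust (n t) with h1 | h1 | h1 | h1 | h1 | h1 | h1 | h1
  · exact (hnot s (by rw [h1, hns]) rfl).elim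
  · refine (hnot (z * s) (by rw [h1, hnz, hns, mul_one]) ?_).elim
    rw [mul_assoc, h.s_mul_z_mul]
  · exact (hnot 1 (by rw [h1, hn1]) (by simp)).elim
  · exact (hnot z (by rw [h1, hzn]) h.s_mul_z.symm).elim
  · have := hreg.ext hn (one_mem N) t h1
    rw [this, Equiv.Perm.one_apply] at hn1
    exact (hcs (by rw [← hn1, mul_one, one_mul])).elim
  · have := hreg.ext hn hz t h1
    rw [this, leftReg_apply, mul_one] at hn1
    exact (hcs (by rw [← hn1, h.z_mul_comm])).elim
  -- Here `m s = m n 1 = n m 1 = n t = st = z ts`, which is the other case with `s` and `t`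
  -- exchanged.
  · refine .inr (heq h.symm (h.symm.groupE_le hz hsq hcomm hm hn hm1 hn1 ?_))
    rw [← h.s_mul_t, ← h1, ← hn1, ← hm1]
    exact Equiv.congr_fun (hcomm m hm n hn) 1
  · exact .inl (heq h (h.groupE_le hz hsq hcomm hn hm hn1 hm1 h1))

end IsQuaternionPair

end Classification

/-- `L/F` is a quaternionic extension whose Galois group is generated by `σ` and `τ`, subject to
the standard relations. -/
theorem mainTheorem4 {F : Type u} {L : Type v} [Field F] [Field L] [Algebra F L]
    [FiniteDimensional F L] [IsGalois F L]
    (hG : Nonempty (Gal(L/F) ≃* QuaternionGroup 2))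
    (σ τ : Gal(L/F)) (hgen : Subgroup.closure {σ, τ} = ⊤)
    (hσ : σ ^ 4 = 1) (hτ : τ ^ 4 = 1) (hστ : σ ^ 2 = τ ^ 2) (hrel : σ * τ = τ * σ⁻¹) :
    (∀ s t : Gal(L/F), (s = σ ∧ t = τ) ∨ (s = τ ∧ t = σ) →
      IsRegularSubgroup (groupE s t) ∧ IsNormalizedByLeftReg (groupE s t) ∧
        Nat.card (groupE s t) = 8 ∧ Nonempty (groupE s t ≃* C2Cubed)) ∧
    groupE σ τ ≠ groupE τ σ ∧
    ∃ S₁ S₂ : HopfGaloisStructure F L,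
      (∀ N, S₁.HasUnderlyingGroup N ↔ N = groupE σ τ) ∧
      (∀ N, S₂.HasUnderlyingGroup N ↔ N = groupE τ σ) ∧
      ¬ S₁.Equivalent S₂ ∧
      ∀ S : HopfGaloisStructure F L,
        S.IsOfType C2Cubed ↔ S.Equivalent S₁ ∨ S.Equivalent S₂ := by
  have h := isQuaternionPair_of_closure_eq_top hG hgen hσ hστ hrel
  have h₁ := HopfGaloisStructure.ofRegular_hasUnderlyingGroup h.groupE_regular.1
    h.isNormalizedByLeftReg_groupE
  have h₂ := HopfGaloisStructure.ofRegular_hasUnderlyingGroup h.symm.groupE_regular.1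
    h.symm.isNormalizedByLeftReg_groupE
  refine ⟨?_, h.groupE_ne, _, _, fun N => ⟨fun hN => hN.unique h₁, fun hN => hN ▸ h₁⟩,
    fun N => ⟨fun hN => hN.unique h₂, fun hN => hN ▸ h₂⟩, ?_, ?_⟩
  · rintro s t (⟨rfl, rfl⟩ | ⟨rfl, rfl⟩)
    · exact ⟨h.groupE_regular.1, h.isNormalizedByLeftReg_groupE, h.groupE_regular.2⟩
    · exact ⟨h.symm.groupE_regular.1, h.symm.isNormalizedByLeftReg_groupE,
        h.symm.groupE_regular.2⟩
  · exact fun heq => h.groupE_ne (h₁.unique (h₂.of_equivalent heq))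
  · refine fun S => ⟨?_, ?_⟩
    · rintro ⟨N, hSN, ⟨e⟩⟩
      have hsq : ∀ η ∈ N, η * η = 1 := by
        intro η hη
        have h1 : (⟨η, hη⟩ : N) * ⟨η, hη⟩ = 1 :=
          e.injective (by rw [map_mul, map_one, C2Cubed.mul_self])
        exact congrArg Subtype.val h1
      rcases h.eq_groupE_or hSN.1 hSN.2.1 hsq with rfl | rfl
      · exact .inl (hSN.equivalent h₁)
      · exact .inr (hSN.equivalent h₂)
    · rintro (hS | hS)
      · exact ⟨_, h₁.of_equivalent hS, h.groupE_regular.2.2⟩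
      · exact ⟨_, h₂.of_equivalent hS, h.symm.groupE_regular.2.2⟩
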